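/- Let $\mathcal Z$ be a measurable space, let $\nu_{\mathcal M}$ and $\nu_{\mathcal P}$ be $\sigma$-finite base measures on $\mathcal Z$ (for instance both equal to counting measure on a countable set, or to Lebesgue measure on a Borel subset of $\mathbb R^k$), and let $X:\mathcal Z\to\mathbb R$ be measurable. The regular single-parameter exponential family with sufficient statistic $X$, base measure $\nu$ and carrier $h:\mathcal Z\to[0,\infty)$ (measurable, not $\nu$-a.e. zero) consists of the distributions with $\nu$-densities $M_\eta(z)=\frac{1}{Z(\eta)}e^{-\eta X(z)}h(z)$, where $Z(\eta)=\int e^{-\eta X}h\,d\nu$ and $\eta$ ranges over the natural parameter space $\Theta_{\rm nat}=\{\eta\in\mathbb R: Z(\eta)<\infty\}$, which is assumed to be a nonempty open interval. Its mean-value parameter space is $\Theta_{\rm mean}=\{E_{M_\eta}[X]:\eta\in\Theta_{\rm nat}\}$, and for $\mu\in\Theta_{\rm mean}$, $M_\mu$ denotes the member of the family (and its density) with $E_{M_\mu}[X]=\mu$. Let $\mathcal M=\{M_\mu\mid\mu\in\Theta_{\rm mean}\}$ (with base measure $\nu_{\mathcal M}$) and $\mathcal P=\{P_\mu\mid\mu\in\Theta_{\rm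 mean}\}$ (with base measure $\nu_{\mathcal P}$) be two such families, possibly with different carriers, with the same sufficient statistic $X$ and the same mean-value parameter space $\Theta_{\rm mean}$. Let $\bar\mu_0\in\Theta_{\rm mean}$ be a constant and, for $n\ge1$, let $\bar\mu_n=\bar\mu_n(z_1,\dots,z_n)\in\Theta_{\rm mean}$ be an arbitrary (measurable) estimator. Let $U$ be the plug-in code based on this sequence, with codelength $$L_U(z^n)=\sum_{i=0}^{n-1}-\ln M_{\bar\mu_i(z_1,\dots,z_i)}(z_{i+1}).$$ For data $Z_1,Z_2,\dots$ i.i.d. from $P$, its relative redundancy is $$\mathcal R_U(n)=E_P[L_U(Z^n)]-\inf_{\mu\in\Theta_{\rm mean}}E_P[-\ln M_\mu(Z^n)],$$ where $M_\mu(z^n)=\prod_{i=1}^n M_\mu(z_i)$, $-\ln 0=+\infty$, and an expectation is set to $+\infty$ if the positive part has infinite expectation. Then for Lebesgue-almost every $\mu^*\in\Theta_{\rm mean}$ the following holds: if the data are i.i.d. from $P=P_{\mu^*}$ and $E_{P_{\mu^*}}[-\ln M_{\mu^*}(Z)]$ is finite (so that $\mathcal R_U(n)$ is well defined), then $$\liminf_{n\to\infty}\frac{\mathcal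 R_U(n)}{\frac12\ln n}\ \ge\ \frac{\mathrm{var}_{P_{\mu^*}}X}{\mathrm{var}_{M_{\mu^*}}X}.$$ -/

import Mathlib

open MeasureTheory ProbabilityTheory Filter
open scoped ENNReal NNReal

noncomputable section

namespace PlugInCodes

/-- The partition function `Z(η) = ∫ e^{-η X(z)} h(z) dν(z)`, with values in `[0, ∞]`.
The base measure `ν` is Lebesgue measure for a continuous outcome space and counting measure for a
countable one. -/
def partitionFun {Z : Type*} [MeasurableSpace Z] (ν : Measure Z) (X : Z → ℝ) (h : Z → ℝ≥0)
    (η : ℝ) : ℝ≥0∞ :=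
  ∫⁻ z, ENNReal.ofReal (Real.exp (-η * X z) * h z) ∂ν

/-- A regular single parameter exponential family with sufficient statistic `X`, with densities
taken with respect to `ν`. The natural parameter space is always convex, so that it is an open
interval as soon as it is open and nonempty. -/
structure ExpFamily {Z : Type*} [MeasurableSpace Z] (ν : Measure Z) (X : Z → ℝ) where
  /-- the carrier `h : Z → [0, ∞)` -/
  carrier : Z → ℝ≥0
  measurable_carrier : Measurable carrier
  carrier_ne_zero : ¬ carrier =ᵐ[ν] 0
  nonempty_natSpace : {η : ℝ | partitionFun ν X carrier η < ∞}.Nonempty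
  isOpen_natSpace : IsOpen {η : ℝ | partitionFun ν X carrier η < ∞}

namespace ExpFamily

variable {Z : Type*} [MeasurableSpace Z] {ν : Measure Z} {X : Z → ℝ}

/-- The natural parameter space. -/
def natSpace (M : ExpFamily ν X) : Set ℝ := {η : ℝ | partitionFun ν X M.carrier η < ∞}

/-- The density `M_η(z) = e^{-η X(z)} h(z) / Z(η)` in the natural parameterization. -/
def natDensity (M : ExpFamily ν X) (η : ℝ) (z : Z) : ℝ :=
  Real.exp (-η * X z) * M.carrier z / (partitionFun ν X M.carrier η).toReal

/-- The distribution `M_η` in the natural parameterization. -/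
def natDist (M : ExpFamily ν X) (η : ℝ) : Measure Z :=
  ν.withDensity fun z => ENNReal.ofReal (M.natDensity η z)

/-- The mean value map `μ(η) = E_{M_η}[X]`. -/
def meanMap (M : ExpFamily ν X) (η : ℝ) : ℝ := ∫ z, X z ∂(M.natDist η)

/-- The mean-value parameter space. -/
def meanSpace (M : ExpFamily ν X) : Set ℝ := M.meanMap '' M.natSpace

/-- The natural parameter that belongs to the mean value `μ`: the inverse of the mean value map. -/
def natOf (M : ExpFamily ν X) (μ : ℝ) : ℝ := Function.invFunOn M.meanMap M.natSpace μ

/-- The density `M_μ` in the mean-value parameterization. -/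
def density (M : ExpFamily ν X) (μ : ℝ) (z : Z) : ℝ := M.natDensity (M.natOf μ) z

/-- The distribution `M_μ` in the mean-value parameterization. -/
def dist (M : ExpFamily ν X) (μ : ℝ) : Measure Z := M.natDist (M.natOf μ)

/-- The log loss `-ln M_μ(z)`, which is `+∞` where the density vanishes. -/
def logLoss (M : ExpFamily ν X) (μ : ℝ) (z : Z) : EReal :=
  -ENNReal.log (ENNReal.ofReal (M.density μ z))

end ExpFamily

/-- The extended expectation `E_P[f] = E_P[f⁺] - E_P[f⁻]` of an extended-real function. It is set
to `+∞` as soon as `E_P[f⁺] = ∞`. -/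
def expect {Ω : Type*} [MeasurableSpace Ω] (P : Measure Ω) (f : Ω → EReal) : EReal :=
  open Classical in
  if ∫⁻ x, (f x).toENNReal ∂P = ∞ then ⊤
  else ((∫⁻ x, (f x).toENNReal ∂P : ℝ≥0∞) : EReal) - ((∫⁻ x, (-f x).toENNReal ∂P : ℝ≥0∞) : EReal)

/-- The law of `n` outcomes drawn independently from `P`. -/
def iidLaw {Z : Type*} [MeasurableSpace Z] (P : Measure Z) (n : ℕ) : Measure (Fin n → Z) :=
  Measure.pi fun _ => P

/-- A sequence of in-model estimators `μ̄₀, μ̄₁, μ̄₂, …`: the estimator `μ̄ₙ` is a function of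
`z₁, …, zₙ` with values in the parameter space `Θ`. In particular `μ̄₀` is a constant. -/
structure EstimatorSeq (Z : Type*) [MeasurableSpace Z] (Θ : Set ℝ) where
  est : (n : ℕ) → (Fin n → Z) → ℝ
  measurable_est : ∀ n, Measurable (est n)
  est_mem : ∀ n z, est n z ∈ Θ

variable {Z : Type*} [MeasurableSpace Z] {ν : Measure Z} {X : Z → ℝ}

/-- The codelength `L_U(zⁿ) = ∑_{i=0}^{n-1} -ln M_{μ̄ᵢ(z₁,…,zᵢ)}(z_{i+1})` of the plug-in code `U`
for `M` based on the estimators `μ̄₀, μ̄₁, …`. -/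
def plugInCodelength (M : ExpFamily ν X) (U : EstimatorSeq Z M.meanSpace) (n : ℕ)
    (z : Fin n → Z) : EReal :=
  ∑ i : Fin n, M.logLoss (U.est i (Fin.take i i.isLt.le z)) (z i)

/-- The codelength `-ln M_μ(zⁿ) = ∑ᵢ -ln M_μ(zᵢ)` of the fixed element `M_μ` of the model. -/
def modelCodelength (M : ExpFamily ν X) (μ : ℝ) (n : ℕ) (z : Fin n → Z) : EReal :=
  ∑ i : Fin n, M.logLoss μ (z i)

/-- The relative redundancy
`R_U(n) = E_P[L_U(Zⁿ)] - inf_{μ ∈ Θ} E_P[-ln M_μ(Zⁿ)]` of the plug-in code for data that are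
i.i.d. from `P`. -/
def redundancy (M : ExpFamily ν X) (U : EstimatorSeq Z M.meanSpace) (P : Measure Z) (n : ℕ) :
    EReal :=
  expect (iidLaw P n) (plugInCodelength M U n)
    - ⨅ μ ∈ M.meanSpace, expect (iidLaw P n) (modelCodelength M μ n)

end PlugInCodes

end

/-!
The data have law `P_μ*`, whose mean is `μ*`, and the log loss of a member of an exponential family
is affine in the statistic `X` up to a term that is the same for all members. Hence the redundancy
of the plug-in code is at least the cumulative divergence `∑_{i<n} E[D(M_μ* ‖ M_μ̄ᵢ)]`, exactly as
if the data came from `M_μ*` (`le_redundancy`). The log losses of the single forecasts need not be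
integrable, and the code length is only known to have an integrable positive part, so the
expectation is computed from the positive and negative parts by a generalized-martingale argument
(`lintegral_scoreSum_of_pos_ne_top`).

As a function of `μ` the divergence `D(M_μ* ‖ M_μ)` has derivative `(μ - μ*) / var M_μ`. On a
small interval around `μ*` the divergences of the two families therefore have a ratio close to
`var P_μ* / var M_μ*`, and projecting an estimate to that interval only decreases the divergence
(`mul_klDivergence_clamp_le`). It remains to see that sequential estimates with values in a compact
interval have cumulative divergence at least `(1 - o(1)) ½ ln n` in the family `P` that generates
the data, for almost every mean (`ae_eventually_le_cumulativeRisk`).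

This is Rissanen's lower bound. Let `Qₙ` be the distribution of the sequential forecasts from `P`.
If the cumulative divergence at `μ` is below `(1-ε)/2 · ln n`, then `Qₙ` gives mass of order at
least `n^{-(1-ε²)/2}` to the data with empirical mean within `O(n^{-1/2})` of `μ`. As `Qₙ` does not
depend on `μ`, Fubini's theorem bounds the volume of such `μ` by a multiple of `n^{-ε²/2}`
(`exists_volume_cumulativeRisk_lt_le`). Along `n = 2ᵏ` these volumes are summable, Borel–Cantelli
applies, and monotonicity of the cumulative divergence fills the gaps.
-/

noncomputable section

lemma measurable_comp_of_continuousOn {α : Type*} [MeasurableSpace α] {s : Set ℝ} {g : ℝ → ℝ}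
    (hg : ContinuousOn g s) {f : α → ℝ} (hf : Measurable f) (hmem : ∀ a, f a ∈ s) :
    Measurable fun a => g (f a) :=
  (continuousOn_iff_continuous_domRestrict.1 hg).measurable.comp (hf.subtype_mk (h := hmem))

/-! ### Exponential families as exponential tilts -/

namespace PlugInCodes.ExpFamily

variable {Z : Type*} [MeasurableSpace Z] {ν : Measure Z} {X : Z → ℝ}

/-- The measure `h ν`. The members of the family are its exponential tilts by `-η X`, so that
Mathlib's theory of the cumulant generating function applies at `t = -η`. -/
def baseMeasure (M : ExpFamily ν X) : Measure Z := ν.withDensity fun z => (M.carrier z : ℝ≥0∞)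

/-- The log-partition function `ln Z(η)`. -/
def logPart (M : ExpFamily ν X) (η : ℝ) : ℝ := cgf X M.baseMeasure (-η)

lemma baseMeasure_ne_zero (M : ExpFamily ν X) : M.baseMeasure ≠ 0 := by
  intro h
  refine M.carrier_ne_zero ?_
  rw [baseMeasure,
    withDensity_eq_zero_iff M.measurable_carrier.coe_nnreal_ennreal.aemeasurable] at h
  filter_upwards [h] with z hz
  simpa using hz

instance (M : ExpFamily ν X) : NeZero M.baseMeasure := ⟨M.baseMeasure_ne_zero⟩

lemma partitionFun_eq_lintegral_exp (M : ExpFamily ν X) (hX : Measurable X) (η : ℝ) :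
    partitionFun ν X M.carrier η = ∫⁻ z, ENNReal.ofReal (Real.exp (-η * X z)) ∂M.baseMeasure := by
  rw [baseMeasure, lintegral_withDensity_eq_lintegral_mul _
    M.measurable_carrier.coe_nnreal_ennreal (by fun_prop), partitionFun]
  refine lintegral_congr fun z => ?_
  rw [ENNReal.ofReal_mul (Real.exp_nonneg _), ENNReal.ofReal_coe_nnreal, mul_comm]
  rfl

lemma mem_natSpace_iff (M : ExpFamily ν X) (hX : Measurable X) {η : ℝ} :
    η ∈ M.natSpace ↔ -η ∈ integrableExpSet X M.baseMeasure := by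
  rw [natSpace, Set.mem_ofPred_eq, M.partitionFun_eq_lintegral_exp hX, integrableExpSet,
    Set.mem_ofPred_eq, ← lintegral_ofReal_ne_top_iff_integrable, lt_top_iff_ne_top]
  · fun_prop
  · exact ae_of_all _ fun _ => Real.exp_nonneg _

lemma natSpace_eq_preimage (M : ExpFamily ν X) (hX : Measurable X) :
    M.natSpace = Neg.neg ⁻¹' integrableExpSet X M.baseMeasure :=
  Set.ext fun _ => M.mem_natSpace_iff hX

lemma isOpen_integrableExpSet (M : ExpFamily ν X) (hX : Measurable X) :
    IsOpen (integrableExpSet X M.baseMeasure) := by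
  have h : integrableExpSet X M.baseMeasure = Neg.neg ⁻¹' M.natSpace := by
    rw [M.natSpace_eq_preimage hX]; ext; simp
  rw [h]
  exact M.isOpen_natSpace.preimage continuous_neg

lemma neg_mem_interior (M : ExpFamily ν X) (hX : Measurable X) {η : ℝ} (hη : η ∈ M.natSpace) :
    -η ∈ interior (integrableExpSet X M.baseMeasure) := by
  rw [(M.isOpen_integrableExpSet hX).interior_eq]
  exact (M.mem_natSpace_iff hX).1 hη

lemma ordConnected_natSpace (M : ExpFamily ν X) (hX : Measurable X) :
    M.natSpace.OrdConnected := by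
  rw [M.natSpace_eq_preimage hX]
  have h : Convex ℝ (Neg.neg ⁻¹' integrableExpSet X M.baseMeasure) :=
    convex_integrableExpSet.is_linear_preimage IsLinearMap.isLinearMap_neg
  exact h.ordConnected

lemma toReal_partitionFun (M : ExpFamily ν X) (hX : Measurable X) (η : ℝ) :
    (partitionFun ν X M.carrier η).toReal = mgf X M.baseMeasure (-η) := by
  rw [M.partitionFun_eq_lintegral_exp hX, mgf, integral_eq_lintegral_of_nonneg_ae]
  · exact ae_of_all _ fun _ => Real.exp_nonneg _
  · fun_prop

lemma natDist_eq_tilted (M : ExpFamily ν X) (hX : Measurable X) (η : ℝ) :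
    M.natDist η = M.baseMeasure.tilted fun z => -η * X z := by
  have h0 : ∫ x, Real.exp (-η * X x) ∂M.baseMeasure = mgf X M.baseMeasure (-η) := rfl
  rw [natDist, Measure.tilted, h0, baseMeasure, ← withDensity_mul _
    M.measurable_carrier.coe_nnreal_ennreal (by fun_prop)]
  congr 1 with z
  rw [natDensity, M.toReal_partitionFun hX, Pi.mul_apply, ← ENNReal.ofReal_coe_nnreal,
    ← ENNReal.ofReal_mul (by positivity)]
  congr 1
  rw [← baseMeasure]
  ring

/-- The density with respect to `h ν`, where the carrier has disappeared. -/
lemma natDist_eq_withDensity (M : ExpFamily ν X) (hX : Measurable X) {η : ℝ}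
    (hη : η ∈ M.natSpace) :
    M.natDist η =
      M.baseMeasure.withDensity fun z => ENNReal.ofReal (Real.exp (-η * X z - M.logPart η)) := by
  rw [M.natDist_eq_tilted hX, Measure.tilted]
  congr 1 with z
  rw [Real.exp_sub, logPart, exp_cgf ((M.mem_natSpace_iff hX).1 hη)]
  rfl

lemma natDensity_eq (M : ExpFamily ν X) (hX : Measurable X) {η : ℝ} (hη : η ∈ M.natSpace) (z : Z) :
    M.natDensity η z = Real.exp (-η * X z - M.logPart η) * M.carrier z := by
  rw [natDensity, M.toReal_partitionFun hX, Real.exp_sub, logPart,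
    exp_cgf ((M.mem_natSpace_iff hX).1 hη)]
  ring

lemma isProbabilityMeasure_natDist (M : ExpFamily ν X) (hX : Measurable X) {η : ℝ}
    (hη : η ∈ M.natSpace) : IsProbabilityMeasure (M.natDist η) := by
  rw [M.natDist_eq_tilted hX]
  exact isProbabilityMeasure_tilted ((M.mem_natSpace_iff hX).1 hη)

lemma memLp_natDist (M : ExpFamily ν X) (hX : Measurable X) {η : ℝ} (hη : η ∈ M.natSpace) :
    MemLp X 2 (M.natDist η) := by
  rw [M.natDist_eq_tilted hX]
  exact memLp_tilted_mul (M.neg_mem_interior hX hη) 2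

lemma integrable_natDist (M : ExpFamily ν X) (hX : Measurable X) {η : ℝ} (hη : η ∈ M.natSpace) :
    Integrable X (M.natDist η) := by
  have := M.isProbabilityMeasure_natDist hX hη
  exact (M.memLp_natDist hX hη).integrable (by norm_num)

lemma meanMap_eq_deriv (M : ExpFamily ν X) (hX : Measurable X) {η : ℝ} (hη : η ∈ M.natSpace) :
    M.meanMap η = deriv (cgf X M.baseMeasure) (-η) := by
  rw [meanMap, M.natDist_eq_tilted hX]
  exact integral_tilted_mul_self (M.neg_mem_interior hX hη)

lemma variance_natDist (M : ExpFamily ν X) (hX : Measurable X) {η : ℝ} (hη : η ∈ M.natSpace) :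
    Var[X; M.natDist η] = deriv (deriv (cgf X M.baseMeasure)) (-η) := by
  rw [M.natDist_eq_tilted hX, variance_tilted_mul (M.neg_mem_interior hX hη), iteratedDeriv_succ,
    iteratedDeriv_one]

lemma hasDerivAt_logPart (M : ExpFamily ν X) (hX : Measurable X) {η : ℝ} (hη : η ∈ M.natSpace) :
    HasDerivAt M.logPart (-M.meanMap η) η := by
  have h := (analyticAt_cgf (M.neg_mem_interior hX hη)).differentiableAt.hasDerivAt
  rw [← M.meanMap_eq_deriv hX hη] at h
  have h2 : HasDerivAt (fun η => cgf X M.baseMeasure (-η)) (-M.meanMap η) η := by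
    simpa [Function.comp_def] using h.scomp η (hasDerivAt_neg η)
  exact h2

lemma hasDerivAt_meanMap (M : ExpFamily ν X) (hX : Measurable X) {η : ℝ} (hη : η ∈ M.natSpace) :
    HasDerivAt M.meanMap (-Var[X; M.natDist η]) η := by
  have h := (analyticAt_cgf (M.neg_mem_interior hX hη)).deriv.differentiableAt.hasDerivAt
  rw [← M.variance_natDist hX hη] at h
  have h2 : HasDerivAt (fun η => deriv (cgf X M.baseMeasure) (-η)) (-Var[X; M.natDist η]) η := by
    simpa [Function.comp_def] using h.scomp η (hasDerivAt_neg η)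
  refine h2.congr_of_eventuallyEq ?_
  filter_upwards [M.isOpen_natSpace.mem_nhds hη] with x hx
  exact M.meanMap_eq_deriv hX hx

lemma continuousAt_variance_natDist (M : ExpFamily ν X) (hX : Measurable X) {η : ℝ}
    (hη : η ∈ M.natSpace) : ContinuousAt (fun η => Var[X; M.natDist η]) η := by
  have h := (analyticAt_cgf (M.neg_mem_interior hX hη)).deriv.deriv.continuousAt
  have h2 : ContinuousAt (fun η => deriv (deriv (cgf X M.baseMeasure)) (-η)) η :=
    ContinuousAt.comp (f := fun η : ℝ => -η) h continuous_neg.continuousAt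
  refine h2.congr ?_
  filter_upwards [M.isOpen_natSpace.mem_nhds hη] with x hx
  exact (M.variance_natDist hX hx).symm

lemma ae_natDist_iff (M : ExpFamily ν X) (hX : Measurable X) {η : ℝ} (hη : η ∈ M.natSpace)
    {p : Z → Prop} : (∀ᵐ z ∂M.natDist η, p z) ↔ ∀ᵐ z ∂M.baseMeasure, p z := by
  rw [M.natDist_eq_tilted hX]
  exact ⟨fun h => (absolutelyContinuous_tilted ((M.mem_natSpace_iff hX).1 hη)).ae_le h,
    fun h => (tilted_absolutelyContinuous _ _).ae_le h⟩

/-- A degenerate family, one whose statistic has variance zero somewhere, has a single mean, since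
all members are mutually absolutely continuous. -/
lemma subsingleton_or_variance_pos (M : ExpFamily ν X) (hX : Measurable X) :
    M.meanSpace.Subsingleton ∨ ∀ η ∈ M.natSpace, 0 < Var[X; M.natDist η] := by
  refine or_iff_not_imp_right.2 fun h => ?_
  push Not at h
  obtain ⟨η, hη, hv⟩ := h
  have := M.isProbabilityMeasure_natDist hX hη
  have h0 : ∀ᵐ z ∂M.natDist η, X z = M.meanMap η := by
    have hle := le_antisymm hv (variance_nonneg X (M.natDist η))
    have he : evariance X (M.natDist η) = 0 := by
      rw [← ofReal_variance (M.memLp_natDist hX hη), hle, ENNReal.ofReal_zero]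
    exact (evariance_eq_zero_iff hX.aemeasurable).1 he
  rw [M.ae_natDist_iff hX hη] at h0
  have hall : ∀ η' ∈ M.natSpace, M.meanMap η' = M.meanMap η := by
    intro η' hη'
    have := M.isProbabilityMeasure_natDist hX hη'
    rw [meanMap, integral_congr_ae ((M.ae_natDist_iff hX hη').2 h0)]
    simp
  rintro _ ⟨η₁, h₁, rfl⟩ _ ⟨η₂, h₂, rfl⟩
  rw [hall _ h₁, hall _ h₂]

/-! ### The mean-value parameterization -/

lemma natOf_mem (M : ExpFamily ν X) {μ : ℝ} (hμ : μ ∈ M.meanSpace) : M.natOf μ ∈ M.natSpace :=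
  Function.invFunOn_mem hμ

lemma meanMap_natOf (M : ExpFamily ν X) {μ : ℝ} (hμ : μ ∈ M.meanSpace) :
    M.meanMap (M.natOf μ) = μ :=
  Function.invFunOn_eq hμ

lemma integral_dist (M : ExpFamily ν X) {μ : ℝ} (hμ : μ ∈ M.meanSpace) :
    ∫ z, X z ∂(M.dist μ) = μ := M.meanMap_natOf hμ

variable (M : ExpFamily ν X) (hX : Measurable X) (hvar : ∀ η ∈ M.natSpace, 0 < Var[X; M.natDist η])

include hX hvar

lemma strictAntiOn_meanMap : StrictAntiOn M.meanMap M.natSpace := by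
  have := M.ordConnected_natSpace hX
  refine strictAntiOn_of_deriv_neg this.convex
    (fun η hη => (M.hasDerivAt_meanMap hX hη).continuousAt.continuousWithinAt) fun η hη => ?_
  have hη' := interior_subset hη
  rw [(M.hasDerivAt_meanMap hX hη').deriv]
  exact neg_neg_of_pos (hvar η hη')

lemma natOf_meanMap {η : ℝ} (hη : η ∈ M.natSpace) : M.natOf (M.meanMap η) = η :=
  (M.strictAntiOn_meanMap hX hvar).injOn (M.natOf_mem ⟨η, hη, rfl⟩) hη
    (M.meanMap_natOf ⟨η, hη, rfl⟩)

lemma antitoneOn_natOf : AntitoneOn M.natOf M.meanSpace := by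
  intro a ha b hb hab
  by_contra h
  push Not at h
  have := M.strictAntiOn_meanMap hX hvar (M.natOf_mem ha) (M.natOf_mem hb) h
  rw [M.meanMap_natOf ha, M.meanMap_natOf hb] at this
  exact absurd hab (not_le.2 this)

lemma image_natOf : M.natOf '' M.meanSpace = M.natSpace := by
  refine Set.Subset.antisymm ?_ fun η hη => ⟨M.meanMap η, ⟨η, hη, rfl⟩, M.natOf_meanMap hX hvar hη⟩
  rintro _ ⟨μ, hμ, rfl⟩
  exact M.natOf_mem hμ

omit hvar in
lemma ordConnected_meanSpace : M.meanSpace.OrdConnected := by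
  have := M.ordConnected_natSpace hX
  refine (this.isPreconnected.image _ fun η hη => ?_).ordConnected
  exact (M.hasDerivAt_meanMap hX hη).continuousAt.continuousWithinAt

lemma isOpen_meanSpace : IsOpen M.meanSpace := by
  rw [isOpen_iff_mem_nhds]
  rintro _ ⟨η, hη, rfl⟩
  have hη' := M.isOpen_natSpace.mem_nhds hη
  obtain ⟨l, u, hlu, hsub⟩ := mem_nhds_iff_exists_Ioo_subset.1 hη'
  obtain ⟨a, ha⟩ := exists_between hlu.1
  obtain ⟨b, hb⟩ := exists_between hlu.2
  have ha' : a ∈ M.natSpace := hsub ⟨ha.1, ha.2.trans hlu.2⟩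
  have hb' : b ∈ M.natSpace := hsub ⟨hlu.1.trans hb.1, hb.2⟩
  have h := M.strictAntiOn_meanMap hX hvar
  refine mem_of_superset (Icc_mem_nhds (h hη hb' hb.1) (h ha' hη ha.2)) ?_
  exact (M.ordConnected_meanSpace hX).out ⟨b, hb', rfl⟩ ⟨a, ha', rfl⟩

lemma continuousAt_natOf {μ : ℝ} (hμ : μ ∈ M.meanSpace) : ContinuousAt M.natOf μ := by
  have h : ContinuousAt (fun μ => -M.natOf μ) μ := by
    refine continuousAt_of_monotoneOn_of_image_mem_nhds (s := M.meanSpace) ?_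
      ((M.isOpen_meanSpace hX hvar).mem_nhds hμ) ?_
    · exact fun a ha b hb hab => neg_le_neg (M.antitoneOn_natOf hX hvar ha hb hab)
    · have : (fun μ => -M.natOf μ) '' M.meanSpace = integrableExpSet X M.baseMeasure := by
        rw [show (fun μ => -M.natOf μ) = Neg.neg ∘ M.natOf from rfl, Set.image_comp,
          M.image_natOf hX hvar, M.natSpace_eq_preimage hX, Set.image_preimage_eq]
        exact neg_surjective
      rw [this]
      exact (M.isOpen_integrableExpSet hX).mem_nhds ((M.mem_natSpace_iff hX).1 (M.natOf_mem hμ))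
  simpa only [Pi.neg_def, neg_neg] using h.neg

lemma hasDerivAt_natOf {μ : ℝ} (hμ : μ ∈ M.meanSpace) :
    HasDerivAt M.natOf (-Var[X; M.dist μ])⁻¹ μ := by
  refine HasDerivAt.of_local_left_inverse (M.continuousAt_natOf hX hvar hμ)
    (M.hasDerivAt_meanMap hX (M.natOf_mem hμ)) ?_ ?_
  · exact neg_ne_zero.2 (hvar _ (M.natOf_mem hμ)).ne'
  · filter_upwards [(M.isOpen_meanSpace hX hvar).mem_nhds hμ] with x hx using M.meanMap_natOf hx

lemma continuousAt_variance_dist {μ : ℝ} (hμ : μ ∈ M.meanSpace) :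
    ContinuousAt (fun μ => Var[X; M.dist μ]) μ :=
  ContinuousAt.comp (f := M.natOf) (M.continuousAt_variance_natDist hX (M.natOf_mem hμ))
    (M.continuousAt_natOf hX hvar hμ)

lemma continuousOn_logPart_natOf : ContinuousOn (fun μ => M.logPart (M.natOf μ)) M.meanSpace :=
  fun _ hμ => (ContinuousAt.comp (f := M.natOf)
    (M.hasDerivAt_logPart hX (M.natOf_mem hμ)).continuousAt
    (M.continuousAt_natOf hX hvar hμ)).continuousWithinAt

lemma continuousOn_natOf : ContinuousOn M.natOf M.meanSpace :=
  fun _ hμ => (M.continuousAt_natOf hX hvar hμ).continuousWithinAt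

omit hX hvar

/-- The Kullback–Leibler divergence `D(M_μ ‖ M_μ')`, in closed form. -/
def klDivergence (μ μ' : ℝ) : ℝ :=
  (M.natOf μ' - M.natOf μ) * μ + M.logPart (M.natOf μ') - M.logPart (M.natOf μ)

@[simp]
lemma klDivergence_self (μ : ℝ) : M.klDivergence μ μ = 0 := by simp [klDivergence]

include hX hvar

lemma hasDerivAt_klDivergence (μ : ℝ) {μ' : ℝ} (hμ' : μ' ∈ M.meanSpace) :
    HasDerivAt (M.klDivergence μ) ((μ' - μ) / Var[X; M.dist μ']) μ' := by
  have h1 := M.hasDerivAt_natOf hX hvar hμ'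
  have h2 := (M.hasDerivAt_logPart hX (M.natOf_mem hμ')).comp μ' h1
  rw [M.meanMap_natOf hμ'] at h2
  have h3 := (((h1.sub_const (M.natOf μ)).mul_const μ).add h2).sub_const (M.logPart (M.natOf μ))
  refine h3.congr_deriv ?_
  rw [inv_neg, div_eq_mul_inv]
  ring

end PlugInCodes.ExpFamily

/-! ### Comparison of the divergences of two families -/

/-- If `F'(t)` has the sign of `t - μ`, then `F` increases when moving away from `μ`. -/
lemma monotoneOn_antitoneOn_of_hasDerivAt_sign {F F' : ℝ → ℝ} {s : Set ℝ} (hs : s.OrdConnected)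
    {μ : ℝ} (hF : ∀ t ∈ s, HasDerivAt F (F' t) t) (hF' : ∀ t ∈ s, 0 ≤ (t - μ) * F' t) :
    MonotoneOn F (s ∩ Set.Ici μ) ∧ AntitoneOn F (s ∩ Set.Iic μ) := by
  constructor
  · refine monotoneOn_of_deriv_nonneg (hs.convex.inter (convex_Ici μ))
      (fun t ht => (hF t ht.1).continuousAt.continuousWithinAt)
      (fun t ht => (hF t (interior_subset ht).1).differentiableAt.differentiableWithinAt)
      fun t ht => ?_
    have h1 : t ∈ Set.Ioi μ := by
      rw [← interior_Ici]
      exact interior_mono Set.inter_subset_right ht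
    rw [(hF t (interior_subset ht).1).deriv]
    exact nonneg_of_mul_nonneg_right (hF' t (interior_subset ht).1) (sub_pos.2 h1)
  · refine antitoneOn_of_deriv_nonpos (hs.convex.inter (convex_Iic μ))
      (fun t ht => (hF t ht.1).continuousAt.continuousWithinAt)
      (fun t ht => (hF t (interior_subset ht).1).differentiableAt.differentiableWithinAt)
      fun t ht => ?_
    have h1 : t ∈ Set.Iio μ := by
      rw [← interior_Iic]
      exact interior_mono Set.inter_subset_right ht
    rw [(hF t (interior_subset ht).1).deriv]
    have h2 := hF' t (interior_subset ht).1
    have h3 : t - μ < 0 := sub_neg.2 h1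
    by_contra hc
    exact absurd h2 (not_le.2 (mul_neg_of_neg_of_pos h3 (not_le.1 hc)))

namespace PlugInCodes.ExpFamily

variable {Z : Type*} [MeasurableSpace Z] {ν ν' : Measure Z} {X : Z → ℝ}

lemma klDivergence_mono_antitone (M : ExpFamily ν X) (hX : Measurable X)
    (hvar : ∀ η ∈ M.natSpace, 0 < Var[X; M.natDist η]) (μ : ℝ) :
    MonotoneOn (M.klDivergence μ) (M.meanSpace ∩ Set.Ici μ) ∧
      AntitoneOn (M.klDivergence μ) (M.meanSpace ∩ Set.Iic μ) := by
  refine monotoneOn_antitoneOn_of_hasDerivAt_sign (M.ordConnected_meanSpace hX)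
    (fun t ht => M.hasDerivAt_klDivergence hX hvar μ ht) fun t ht => ?_
  rw [← mul_div_assoc]
  exact div_nonneg (mul_self_nonneg _) (variance_nonneg _ _)

lemma klDivergence_nonneg (M : ExpFamily ν X) (hX : Measurable X)
    (hvar : ∀ η ∈ M.natSpace, 0 < Var[X; M.natDist η]) {μ μ' : ℝ} (hμ : μ ∈ M.meanSpace)
    (hμ' : μ' ∈ M.meanSpace) : 0 ≤ M.klDivergence μ μ' := by
  have h := M.klDivergence_mono_antitone hX hvar μ
  rw [← M.klDivergence_self μ]
  rcases le_total μ μ' with hle | hle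
  · exact h.1 ⟨hμ, Set.mem_Ici.2 le_rfl⟩ ⟨hμ', hle⟩ hle
  · exact h.2 ⟨hμ', hle⟩ ⟨hμ, Set.mem_Iic.2 le_rfl⟩ hle

/-- Replacing `μ'` by its projection to an interval around `μ` decreases the divergence, and within
the interval the divergences of two families compare as the reciprocals of their variances. -/
lemma mul_klDivergence_clamp_le (M : ExpFamily ν X) (P : ExpFamily ν' X) (hX : Measurable X)
    (hM : ∀ η ∈ M.natSpace, 0 < Var[X; M.natDist η])
    (hP : ∀ η ∈ P.natSpace, 0 < Var[X; P.natDist η]) (hΘ : M.meanSpace = P.meanSpace)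
    {a b k : ℝ} (hab : Set.Icc a b ⊆ M.meanSpace)
    (hk : ∀ t ∈ Set.Icc a b, k * Var[X; M.dist t] ≤ Var[X; P.dist t])
    {μ μ' : ℝ} (hμ : μ ∈ Set.Icc a b) (hμ' : μ' ∈ M.meanSpace) :
    k * P.klDivergence μ (max a (min b μ')) ≤ M.klDivergence μ μ' := by
  have hle : a ≤ b := hμ.1.trans hμ.2
  have hc : max a (min b μ') ∈ Set.Icc a b := ⟨le_max_left _ _, max_le hle (min_le_left _ _)⟩
  have h1 : M.klDivergence μ (max a (min b μ')) ≤ M.klDivergence μ μ' := by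
    have h := M.klDivergence_mono_antitone hX hM μ
    rcases le_total μ μ' with h2 | h2
    · have hge : μ ≤ max a (min b μ') := (le_min hμ.2 h2).trans (le_max_right _ _)
      exact h.1 ⟨hab hc, hge⟩ ⟨hμ', h2⟩ (max_le (hμ.1.trans h2) (min_le_right _ _))
    · have hge : max a (min b μ') ≤ μ := max_le hμ.1 ((min_le_right _ _).trans h2)
      refine h.2 ⟨hμ', h2⟩ ⟨hab hc, hge⟩ ?_
      rw [min_eq_right (h2.trans hμ.2)]
      exact le_max_right _ _
  refine le_trans ?_ h1
  have hF := monotoneOn_antitoneOn_of_hasDerivAt_sign (s := Set.Icc a b) (μ := μ)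
    (F := fun t => M.klDivergence μ t - k * P.klDivergence μ t) Set.ordConnected_Icc
    (fun t ht => (M.hasDerivAt_klDivergence hX hM μ (hab ht)).sub
      ((P.hasDerivAt_klDivergence hX hP μ (hΘ ▸ hab ht)).const_mul k)) (fun t ht => by
        have hvM : 0 < Var[X; M.dist t] := hM _ (M.natOf_mem (hab ht))
        have hvP : 0 < Var[X; P.dist t] := hP _ (P.natOf_mem (hΘ ▸ hab ht))
        have h3 : k / Var[X; P.dist t] ≤ 1 / Var[X; M.dist t] := by
          rw [div_le_div_iff₀ hvP hvM, one_mul]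
          exact hk t ht
        have h4 : (t - μ) * ((t - μ) / Var[X; M.dist t] - k * ((t - μ) / Var[X; P.dist t])) =
            (t - μ) ^ 2 * (1 / Var[X; M.dist t] - k / Var[X; P.dist t]) := by ring
        rw [h4]
        exact mul_nonneg (sq_nonneg _) (sub_nonneg.2 h3))
  rcases le_total μ (max a (min b μ')) with h2 | h2
  · have := hF.1 ⟨hμ, Set.mem_Ici.2 le_rfl⟩ ⟨hc, h2⟩ h2
    simpa using this
  · have := hF.2 ⟨hc, h2⟩ ⟨hμ, Set.mem_Iic.2 le_rfl⟩ h2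
    simpa using this

end PlugInCodes.ExpFamily

/-! ### Sums of sequential scores of i.i.d. outcomes -/

namespace PlugInCodes

variable {Z : Type*} [MeasurableSpace Z]

/-- The sum `∑_{i<n} yᵢ(z₁,…,zᵢ; z_{i+1})` of scores, each of which depends on one outcome and on
the outcomes before it. -/
def scoreSum (y : (i : ℕ) → (Fin i → Z) → Z → ℝ) (n : ℕ) (z : Fin n → Z) : ℝ :=
  ∑ i : Fin n, y i (Fin.take i i.isLt.le z) (z i)

instance (P : Measure Z) [IsProbabilityMeasure P] (n : ℕ) : IsProbabilityMeasure (iidLaw P n) := by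
  unfold iidLaw; infer_instance

omit [MeasurableSpace Z] in
lemma scoreSum_snoc (y : (i : ℕ) → (Fin i → Z) → Z → ℝ) (n : ℕ) (a : Fin n → Z) (b : Z) :
    scoreSum y (n + 1) (Fin.snoc (α := fun _ => Z) a b) = scoreSum y n a + y n a b := by
  have htake : ∀ (m : ℕ) (h : m ≤ n) (h' : m ≤ n + 1),
      Fin.take m h' (Fin.snoc (α := fun _ => Z) a b) = Fin.take m h a := by
    intro m h h'
    funext j
    have : Fin.castLE h' j = Fin.castSucc (Fin.castLE h j) := rfl
    simp only [Fin.take_apply, this, Fin.snoc_castSucc]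
  unfold scoreSum
  rw [Fin.sum_univ_castSucc]
  congr 1
  · refine Finset.sum_congr rfl fun i _ => ?_
    rw [Fin.snoc_castSucc]
    exact congrArg (fun t => y i t (a i)) (htake i i.isLt.le (Fin.castSucc i).isLt.le)
  · rw [Fin.snoc_last]
    exact congrArg (fun t => y n t b) ((htake n le_rfl (Fin.last n).isLt.le).trans (by ext; rfl))

lemma measurable_take {n i : ℕ} (h : i ≤ n) : Measurable fun z : Fin n → Z => Fin.take i h z :=
  measurable_pi_iff.2 fun _ => measurable_pi_apply _

lemma measurable_snoc {n : ℕ} :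
    Measurable fun p : (Fin n → Z) × Z =>
      (Fin.snoc (α := fun _ => Z) p.1 p.2 : Fin (n + 1) → Z) := by
  refine measurable_pi_iff.2 fun i => ?_
  induction i using Fin.lastCases with
  | last => simpa using measurable_snd
  | cast i =>
    simp only [Fin.snoc_castSucc]
    exact (measurable_pi_apply i).comp measurable_fst

lemma measurable_scoreSum {y : (i : ℕ) → (Fin i → Z) → Z → ℝ}
    (hy : ∀ i, Measurable fun p : (Fin i → Z) × Z => y i p.1 p.2) (n : ℕ) :
    Measurable (scoreSum y n) :=
  Finset.measurable_sum _ fun i _ =>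
    (hy i).comp ((measurable_take i.isLt.le).prodMk (measurable_pi_apply i))

/-- Fubini, splitting off the last outcome. -/
lemma lintegral_iidLaw_succ (P : Measure Z) [IsProbabilityMeasure P] (n : ℕ)
    {f : (Fin (n + 1) → Z) → ℝ≥0∞} (hf : Measurable f) :
    ∫⁻ z, f z ∂iidLaw P (n + 1) =
      ∫⁻ a, ∫⁻ b, f (Fin.snoc (α := fun _ => Z) a b) ∂P ∂iidLaw P n := by
  have h := (measurePreserving_piFinSuccAbove (fun _ : Fin (n + 1) => P) (Fin.last n)).symm
  have hf' : Measurable fun p : Z × (Fin n → Z) => f (Fin.snoc (α := fun _ => Z) p.2 p.1) :=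
    hf.comp (measurable_snoc.comp measurable_swap)
  rw [iidLaw, ← h.lintegral_comp hf]
  have h2 : ∀ p : Z × (Fin n → Z),
      (MeasurableEquiv.piFinSuccAbove (fun _ : Fin (n + 1) => Z) (Fin.last n)).symm p =
        Fin.snoc (α := fun _ => Z) p.2 p.1 := by
    intro p
    rw [MeasurableEquiv.piFinSuccAbove_symm_apply]
    exact Fin.insertNth_last' _ _
  simp_rw [h2]
  rw [lintegral_prod_symm _ hf'.aemeasurable]
  rfl

/-- `E[(s + Y)⁺] - E[(s + Y)⁻] = (s + E Y)⁺ - (s + E Y)⁻`, without subtraction. -/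
lemma lintegral_pos_add_neg {P : Measure Z} [IsProbabilityMeasure P] {Y : Z → ℝ}
    (hY : Integrable Y P) (s : ℝ) :
    ∫⁻ b, ENNReal.ofReal (s + Y b) ∂P + ENNReal.ofReal (-(s + ∫ b, Y b ∂P)) =
      ∫⁻ b, ENNReal.ofReal (-(s + Y b)) ∂P + ENNReal.ofReal (s + ∫ b, Y b ∂P) := by
  have hi : Integrable (fun b => s + Y b) P := (integrable_const s).add hY
  have h := integral_eq_lintegral_pos_part_sub_lintegral_neg_part hi
  rw [integral_add (integrable_const s) hY, integral_const, probReal_univ, one_smul] at h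
  have hA : ∫⁻ b, ENNReal.ofReal (s + Y b) ∂P ≠ ∞ := hi.lintegral_lt_top.ne
  have hB : ∫⁻ b, ENNReal.ofReal (-(s + Y b)) ∂P ≠ ∞ := hi.neg.lintegral_lt_top.ne
  rw [h, ← ENNReal.toReal_eq_toReal_iff' (by finiteness) (by finiteness),
    ENNReal.toReal_add hA (by finiteness), ENNReal.toReal_add hB (by finiteness),
    ENNReal.toReal_ofReal', ENNReal.toReal_ofReal']
  set u := (∫⁻ b, ENNReal.ofReal (s + Y b) ∂P).toReal
  set v := (∫⁻ b, ENNReal.ofReal (-(s + Y b)) ∂P).toReal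
  rcases le_total u v with huv | huv
  · rw [max_eq_left (by linarith), max_eq_right (by linarith)]; ring
  · rw [max_eq_right (by linarith), max_eq_left (by linarith)]; ring

lemma ofReal_add_add_ofReal_neg {s d : ℝ} (hd : 0 ≤ d) :
    ENNReal.ofReal (s + d) + ENNReal.ofReal (-s) =
      ENNReal.ofReal s + ENNReal.ofReal d + ENNReal.ofReal (-(s + d)) := by
  rcases le_total 0 s with hs | hs
  · rw [ENNReal.ofReal_add hs hd, ENNReal.ofReal_of_nonpos (by linarith : -s ≤ 0),
      ENNReal.ofReal_of_nonpos (by linarith : -(s + d) ≤ 0)]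
  · rw [ENNReal.ofReal_of_nonpos hs, zero_add]
    rcases le_total 0 (s + d) with h | h
    · rw [ENNReal.ofReal_of_nonpos (by linarith : -(s + d) ≤ 0),
        ← ENNReal.ofReal_add h (by linarith)]
      simp
    · rw [ENNReal.ofReal_of_nonpos h, zero_add, ← ENNReal.ofReal_add hd (by linarith)]
      congr 1
      ring

section Score

variable {P : Measure Z} [IsProbabilityMeasure P] {y : (i : ℕ) → (Fin i → Z) → Z → ℝ}
  {D : (i : ℕ) → (Fin i → Z) → ℝ}

/-- Induction step for `lintegral_scoreSum_of_pos_ne_top` and `lintegral_scoreSum_of_neg_ne_top`: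
the relations between the positive and negative parts of `S_{n+1}` and of `S_n + D_n`, the
conditional expectation of `S_{n+1}`. -/
lemma lintegral_scoreSum_succ (hy : ∀ i, Measurable fun p : (Fin i → Z) × Z => y i p.1 p.2)
    (hD : ∀ i, Measurable (D i)) (hint : ∀ i a, Integrable (y i a) P)
    (hyD : ∀ i a, ∫ b, y i a b ∂P = D i a) (hD0 : ∀ i a, 0 ≤ D i a) (n : ℕ) :
    ∃ p q : ℝ≥0∞,
      ∫⁻ z, ENNReal.ofReal (scoreSum y (n + 1) z) ∂iidLaw P (n + 1) + q =
        ∫⁻ z, ENNReal.ofReal (-scoreSum y (n + 1) z) ∂iidLaw P (n + 1) + p ∧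
      p + ∫⁻ z, ENNReal.ofReal (-scoreSum y n z) ∂iidLaw P n =
        ∫⁻ z, ENNReal.ofReal (scoreSum y n z) ∂iidLaw P n +
          ∫⁻ z, ENNReal.ofReal (D n z) ∂iidLaw P n + q ∧
      p ≤ ∫⁻ z, ENNReal.ofReal (scoreSum y (n + 1) z) ∂iidLaw P (n + 1) ∧
      ∫⁻ z, ENNReal.ofReal (scoreSum y n z) ∂iidLaw P n ≤ p ∧
      q ≤ ∫⁻ z, ENNReal.ofReal (-scoreSum y n z) ∂iidLaw P n := by
  have hS := measurable_scoreSum hy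
  have hpt : ∀ a, ∫⁻ b, ENNReal.ofReal (scoreSum y n a + y n a b) ∂P +
      ENNReal.ofReal (-(scoreSum y n a + D n a)) =
      ∫⁻ b, ENNReal.ofReal (-(scoreSum y n a + y n a b)) ∂P +
        ENNReal.ofReal (scoreSum y n a + D n a) := by
    intro a
    rw [← hyD]
    exact lintegral_pos_add_neg (hint n a) _
  have hSD : Measurable fun a => scoreSum y n a + D n a := (hS n).add (hD n)
  have hSDneg : Measurable fun a => ENNReal.ofReal (-(scoreSum y n a + D n a)) := by fun_prop
  have hSneg : Measurable fun a => ENNReal.ofReal (-scoreSum y n a) := (hS n).neg.ennreal_ofReal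
  have hsucc : ∀ g : ℝ → ℝ, Measurable g →
      ∫⁻ z, ENNReal.ofReal (g (scoreSum y (n + 1) z)) ∂iidLaw P (n + 1) =
        ∫⁻ a, ∫⁻ b, ENNReal.ofReal (g (scoreSum y n a + y n a b)) ∂P ∂iidLaw P n := by
    intro g hg
    have hS' := hS (n + 1)
    rw [lintegral_iidLaw_succ P n (by fun_prop)]
    simp_rw [scoreSum_snoc]
  refine ⟨∫⁻ a, ENNReal.ofReal (scoreSum y n a + D n a) ∂iidLaw P n,
    ∫⁻ a, ENNReal.ofReal (-(scoreSum y n a + D n a)) ∂iidLaw P n, ?_, ?_, ?_, ?_, ?_⟩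
  · rw [hsucc (fun x => x) measurable_id, hsucc (fun x => -x) measurable_neg,
      ← lintegral_add_right _ hSDneg, ← lintegral_add_right _ hSD.ennreal_ofReal]
    exact lintegral_congr hpt
  · rw [← lintegral_add_right _ hSneg,
      ← lintegral_add_right _ (hD n).ennreal_ofReal, ← lintegral_add_right _ hSDneg]
    exact lintegral_congr fun a => ofReal_add_add_ofReal_neg (hD0 n a)
  · rw [hsucc (fun x => x) measurable_id]
    refine lintegral_mono fun a => ?_
    rcases le_total 0 (scoreSum y n a + D n a) with h | h
    · have := hpt a
      rw [ENNReal.ofReal_of_nonpos (by linarith : -(scoreSum y n a + D n a) ≤ 0), add_zero] at this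
      rw [this]
      exact le_add_self
    · rw [ENNReal.ofReal_of_nonpos h]
      exact zero_le
  · exact lintegral_mono fun a => ENNReal.ofReal_le_ofReal (by linarith [hD0 n a])
  · exact lintegral_mono fun a => ENNReal.ofReal_le_ofReal (by linarith [hD0 n a])

lemma add_cancel_of_ne_top {x x' p q s d r r' : ℝ≥0∞} (h1 : x + q = r + p)
    (h2 : p + r' = x' + d + q) (h3 : x' = r' + s) (hp : p ≠ ∞) (hq : q ≠ ∞) (hr' : r' ≠ ∞) :
    x = r + (s + d) := by
  have hpqr : p + q + r' ≠ ∞ := by finiteness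
  refine (ENNReal.add_left_inj hpqr).1 ?_
  calc x + (p + q + r') = (x + q) + (p + r') := by ring
    _ = (r + p) + (r' + s + d + q) := by rw [h1, h2, h3]
    _ = r + (s + d) + (p + q + r') := by ring

/-- If the positive part of a sum of scores with nonnegative conditional means is integrable, then
so is the negative part, and the expectation is the sum of the expected conditional means. Single
scores need not be integrable a priori. -/
lemma lintegral_scoreSum_of_pos_ne_top
    (hy : ∀ i, Measurable fun p : (Fin i → Z) × Z => y i p.1 p.2)
    (hD : ∀ i, Measurable (D i)) (hint : ∀ i a, Integrable (y i a) P)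
    (hyD : ∀ i a, ∫ b, y i a b ∂P = D i a) (hD0 : ∀ i a, 0 ≤ D i a) (n : ℕ)
    (hpos : ∫⁻ z, ENNReal.ofReal (scoreSum y n z) ∂iidLaw P n ≠ ∞) :
    ∫⁻ z, ENNReal.ofReal (-scoreSum y n z) ∂iidLaw P n ≠ ∞ ∧
    ∫⁻ z, ENNReal.ofReal (scoreSum y n z) ∂iidLaw P n =
      ∫⁻ z, ENNReal.ofReal (-scoreSum y n z) ∂iidLaw P n +
        ∑ i ∈ Finset.range n, ∫⁻ z, ENNReal.ofReal (D i z) ∂iidLaw P i := by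
  induction n with
  | zero => simp [scoreSum]
  | succ n ih =>
    obtain ⟨p, q, h1, h2, h3, h4, h5⟩ := lintegral_scoreSum_succ hy hD hint hyD hD0 n
    have hp : p ≠ ∞ := ne_top_of_le_ne_top hpos h3
    obtain ⟨hneg, heq⟩ := ih (ne_top_of_le_ne_top hp h4)
    have hq : q ≠ ∞ := ne_top_of_le_ne_top hneg h5
    refine ⟨ne_top_of_le_ne_top (ENNReal.add_ne_top.2 ⟨hpos, hq⟩) (h1 ▸ le_self_add), ?_⟩
    rw [Finset.sum_range_succ]
    exact add_cancel_of_ne_top h1 h2 heq hp hq hneg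

/-- The same formula for the expectation, when the negative parts and the conditional means are
known to be integrable. -/
lemma lintegral_scoreSum_of_neg_ne_top
    (hy : ∀ i, Measurable fun p : (Fin i → Z) × Z => y i p.1 p.2)
    (hD : ∀ i, Measurable (D i)) (hint : ∀ i a, Integrable (y i a) P)
    (hyD : ∀ i a, ∫ b, y i a b ∂P = D i a) (hD0 : ∀ i a, 0 ≤ D i a)
    (hneg : ∀ n, ∫⁻ z, ENNReal.ofReal (-scoreSum y n z) ∂iidLaw P n ≠ ∞) (n : ℕ)
    (hsum : ∑ i ∈ Finset.range n, ∫⁻ z, ENNReal.ofReal (D i z) ∂iidLaw P i ≠ ∞) :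
    ∫⁻ z, ENNReal.ofReal (scoreSum y n z) ∂iidLaw P n =
      ∫⁻ z, ENNReal.ofReal (-scoreSum y n z) ∂iidLaw P n +
        ∑ i ∈ Finset.range n, ∫⁻ z, ENNReal.ofReal (D i z) ∂iidLaw P i := by
  induction n with
  | zero => simp [scoreSum]
  | succ n ih =>
    obtain ⟨p, q, h1, h2, h3, h4, h5⟩ := lintegral_scoreSum_succ hy hD hint hyD hD0 n
    rw [Finset.sum_range_succ] at hsum ⊢
    obtain ⟨hs, hd⟩ := ENNReal.add_ne_top.1 hsum
    have heq := ih hs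
    have hq : q ≠ ∞ := ne_top_of_le_ne_top (hneg n) h5
    have hp : p ≠ ∞ := by
      refine ne_top_of_le_ne_top ?_ (h2 ▸ le_self_add)
      rw [heq]
      exact ENNReal.add_ne_top.2 ⟨ENNReal.add_ne_top.2
        ⟨ENNReal.add_ne_top.2 ⟨hneg n, hs⟩, hd⟩, hq⟩
    exact add_cancel_of_ne_top h1 h2 heq hp hq (hneg n)

/-- If each score `y` is the log-likelihood ratio of `P` and a sequential forecast, then the
forecast distribution `e^{-S_n} Pⁿ` on the data depends on the forecasts alone, not on `P`. -/
lemma lintegral_mul_exp_neg_scoreSum_congr {P' : Measure Z} [IsProbabilityMeasure P']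
    {y' : (i : ℕ) → (Fin i → Z) → Z → ℝ}
    (hy : ∀ i, Measurable fun p : (Fin i → Z) × Z => y i p.1 p.2)
    (hy' : ∀ i, Measurable fun p : (Fin i → Z) × Z => y' i p.1 p.2)
    (h : ∀ i a, P.withDensity (fun b => ENNReal.ofReal (Real.exp (-y i a b))) =
      P'.withDensity fun b => ENNReal.ofReal (Real.exp (-y' i a b))) (n : ℕ)
    {f : (Fin n → Z) → ℝ≥0∞} (hf : Measurable f) :
    ∫⁻ z, ENNReal.ofReal (Real.exp (-scoreSum y n z)) * f z ∂iidLaw P n =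
      ∫⁻ z, ENNReal.ofReal (Real.exp (-scoreSum y' n z)) * f z ∂iidLaw P' n := by
  -- Integrating out the last outcome leaves a function of the earlier ones that is the same on
  -- both sides.
  have key : ∀ (P : Measure Z) [IsProbabilityMeasure P] (y : (i : ℕ) → (Fin i → Z) → Z → ℝ)
      (_ : ∀ i, Measurable fun p : (Fin i → Z) × Z => y i p.1 p.2) (n : ℕ)
      (f : (Fin (n + 1) → Z) → ℝ≥0∞) (_ : Measurable f),
      ∫⁻ z, ENNReal.ofReal (Real.exp (-scoreSum y (n + 1) z)) * f z ∂iidLaw P (n + 1) =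
        ∫⁻ a, ENNReal.ofReal (Real.exp (-scoreSum y n a)) *
          ∫⁻ b, f (Fin.snoc (α := fun _ => Z) a b)
            ∂P.withDensity (fun b => ENNReal.ofReal (Real.exp (-y n a b))) ∂iidLaw P n := by
    intro P _ y hy n f hf
    have hS := measurable_scoreSum hy
    rw [lintegral_iidLaw_succ P n (by fun_prop)]
    refine lintegral_congr fun a => ?_
    have hya : Measurable (y n a) := (hy n).comp measurable_prodMk_left
    have hfa : Measurable fun b => f (Fin.snoc (α := fun _ => Z) a b) :=
      hf.comp (measurable_snoc.comp measurable_prodMk_left)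
    rw [lintegral_withDensity_eq_lintegral_mul _ (by fun_prop) hfa,
      ← lintegral_const_mul _ (Measurable.mul (by fun_prop) hfa)]
    refine lintegral_congr fun b => ?_
    rw [scoreSum_snoc, neg_add, Real.exp_add, ENNReal.ofReal_mul (Real.exp_nonneg _), Pi.mul_apply,
      mul_assoc]
  induction n with
  | zero =>
    have h1 : iidLaw P 0 = iidLaw P' 0 := by
      rw [iidLaw, iidLaw, Measure.pi_of_empty, Measure.pi_of_empty]
    rw [h1]
    simp [scoreSum]
  | succ n ih =>
    rw [key P y hy n f hf, key P' y' hy' n f hf]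
    have hy1 := hy n
    have hg : Measurable fun a => ∫⁻ b, f (Fin.snoc (α := fun _ => Z) a b)
        ∂P.withDensity (fun b => ENNReal.ofReal (Real.exp (-y n a b))) := by
      have hrw : ∀ a, ∫⁻ b, f (Fin.snoc (α := fun _ => Z) a b)
          ∂P.withDensity (fun b => ENNReal.ofReal (Real.exp (-y n a b))) =
          ∫⁻ b, ENNReal.ofReal (Real.exp (-y n a b)) * f (Fin.snoc (α := fun _ => Z) a b) ∂P := by
        intro a
        have hya : Measurable (y n a) := (hy n).comp measurable_prodMk_left
        exact lintegral_withDensity_eq_lintegral_mul _ (by fun_prop)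
          (hf.comp (measurable_snoc.comp measurable_prodMk_left))
      simp_rw [hrw]
      have hm : Measurable fun p : (Fin n → Z) × Z =>
          ENNReal.ofReal (Real.exp (-y n p.1 p.2)) * f (Fin.snoc (α := fun _ => Z) p.1 p.2) :=
        (Real.measurable_exp.comp hy1.neg).ennreal_ofReal.mul (hf.comp measurable_snoc)
      exact hm.lintegral_prod_right'
    rw [ih hg]
    simp_rw [h n]

lemma lintegral_exp_neg_scoreSum
    (hy : ∀ i, Measurable fun p : (Fin i → Z) × Z => y i p.1 p.2)
    (h : ∀ i a, ∫⁻ b, ENNReal.ofReal (Real.exp (-y i a b)) ∂P = 1) (n : ℕ) :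
    ∫⁻ z, ENNReal.ofReal (Real.exp (-scoreSum y n z)) ∂iidLaw P n = 1 := by
  have hS := measurable_scoreSum hy
  induction n with
  | zero => simp [scoreSum]
  | succ n ih =>
    rw [lintegral_iidLaw_succ P n (by fun_prop), ← ih]
    refine lintegral_congr fun a => ?_
    have hya : Measurable (y n a) := (hy n).comp measurable_prodMk_left
    simp_rw [scoreSum_snoc, neg_add, Real.exp_add, ENNReal.ofReal_mul (Real.exp_nonneg _)]
    rw [lintegral_const_mul _ (by fun_prop), h, mul_one]

end Score

end PlugInCodes

/-! ### Log-likelihood ratios within a family -/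

namespace PlugInCodes.ExpFamily

variable {Z : Type*} [MeasurableSpace Z] {ν : Measure Z} {X : Z → ℝ} (M : ExpFamily ν X)

/-- The log-likelihood ratio `ln (M_μ(z) / M_μ'(z))`, with the carriers cancelled. -/
def logRatio (μ μ' : ℝ) (z : Z) : ℝ :=
  (M.natOf μ' - M.natOf μ) * X z + M.logPart (M.natOf μ') - M.logPart (M.natOf μ)

variable (hX : Measurable X)

include hX

lemma isProbabilityMeasure_dist {μ : ℝ} (hμ : μ ∈ M.meanSpace) :
    IsProbabilityMeasure (M.dist μ) :=
  M.isProbabilityMeasure_natDist hX (M.natOf_mem hμ)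

lemma withDensity_exp_neg_logRatio {μ μ' : ℝ} (hμ : μ ∈ M.meanSpace) (hμ' : μ' ∈ M.meanSpace) :
    (M.dist μ).withDensity (fun z => ENNReal.ofReal (Real.exp (-M.logRatio μ μ' z))) =
      M.dist μ' := by
  unfold logRatio
  rw [dist, dist, M.natDist_eq_withDensity hX (M.natOf_mem hμ),
    M.natDist_eq_withDensity hX (M.natOf_mem hμ'), ← withDensity_mul _ (by fun_prop) (by fun_prop)]
  congr 1 with z
  rw [Pi.mul_apply, ← ENNReal.ofReal_mul (Real.exp_nonneg _), ← Real.exp_add]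
  congr 2
  ring

lemma integrable_dist {μ : ℝ} (hμ : μ ∈ M.meanSpace) : Integrable X (M.dist μ) :=
  M.integrable_natDist hX (M.natOf_mem hμ)

omit hX in
lemma integrable_logRatio {Q : Measure Z} [IsProbabilityMeasure Q] (hXi : Integrable X Q)
    (μ μ' : ℝ) : Integrable (M.logRatio μ μ') Q :=
  ((hXi.const_mul _).add (integrable_const _)).sub (integrable_const _)

omit hX in
/-- Since the log-likelihood ratio is affine in `X`, its expectation under any distribution with
mean `μ` is the divergence within the family. -/
lemma integral_logRatio {Q : Measure Z} [IsProbabilityMeasure Q] (hXi : Integrable X Q) {μ : ℝ}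
    (hμ : ∫ z, X z ∂Q = μ) (μ' : ℝ) : ∫ z, M.logRatio μ μ' z ∂Q = M.klDivergence μ μ' := by
  have h1 : Integrable (fun z => (M.natOf μ' - M.natOf μ) * X z + M.logPart (M.natOf μ')) Q :=
    (hXi.const_mul _).add (integrable_const _)
  unfold logRatio
  rw [integral_sub h1 (integrable_const _), integral_add (hXi.const_mul _) (integrable_const _),
    integral_const_mul, hμ]
  simp [klDivergence]

lemma measurable_logRatio (hvar : ∀ η ∈ M.natSpace, 0 < Var[X; M.natDist η]) (μ : ℝ)
    {α : Type*} [MeasurableSpace α] {f : α → ℝ} (hf : Measurable f)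
    (hmem : ∀ a, f a ∈ M.meanSpace) : Measurable fun p : α × Z => M.logRatio μ (f p.1) p.2 := by
  have h1 := measurable_comp_of_continuousOn (M.continuousOn_natOf hX hvar) hf hmem
  have h2 := measurable_comp_of_continuousOn (M.continuousOn_logPart_natOf hX hvar) hf hmem
  have h1' : Measurable fun p : α × Z => M.natOf (f p.1) := h1.comp measurable_fst
  have h2' : Measurable fun p : α × Z => M.logPart (M.natOf (f p.1)) := h2.comp measurable_fst
  exact (((h1'.sub_const _).mul (hX.comp measurable_snd)).add h2').sub_const _

lemma measurable_klDivergence (hvar : ∀ η ∈ M.natSpace, 0 < Var[X; M.natDist η]) (μ : ℝ)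
    {α : Type*} [MeasurableSpace α] {f : α → ℝ} (hf : Measurable f)
    (hmem : ∀ a, f a ∈ M.meanSpace) : Measurable fun a => M.klDivergence μ (f a) := by
  have h1 := measurable_comp_of_continuousOn (M.continuousOn_natOf hX hvar) hf hmem
  have h2 := measurable_comp_of_continuousOn (M.continuousOn_logPart_natOf hX hvar) hf hmem
  unfold klDivergence
  fun_prop

lemma exists_variance_le (hvar : ∀ η ∈ M.natSpace, 0 < Var[X; M.natDist η]) {a b : ℝ}
    (hab : Set.Icc a b ⊆ M.meanSpace) :
    ∃ V : ℝ, 0 < V ∧ ∀ μ ∈ Set.Icc a b, Var[X; M.dist μ] ≤ V := by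
  have hc : ContinuousOn (fun μ => Var[X; M.dist μ]) (Set.Icc a b) := fun μ hμ =>
    (M.continuousAt_variance_dist hX hvar (hab hμ)).continuousWithinAt
  obtain ⟨V, hV⟩ := isCompact_Icc.bddAbove_image hc
  exact ⟨max V 1, by positivity, fun μ hμ => (hV ⟨μ, hμ, rfl⟩).trans (le_max_left _ _)⟩

end PlugInCodes.ExpFamily

namespace PlugInCodes

/-! ### A lower bound on the divergence of sequential estimates, for almost every mean -/

variable {Z : Type*} [MeasurableSpace Z]

/-- Chebyshev's inequality for a sum of i.i.d. variables. -/
lemma iidLaw_abs_sum_sub_ge_le {P : Measure Z} [IsProbabilityMeasure P] {X : Z → ℝ}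
    (hX : Measurable X) (hLp : MemLp X 2 P) {V : ℝ} (hV : Var[X; P] ≤ V) {n : ℕ} (hn : 0 < n)
    {C : ℝ} (hC : 0 < C) :
    iidLaw P n {z | C * √n ≤ |∑ i, X (z i) - n * ∫ x, X x ∂P|} ≤ ENNReal.ofReal (V / C ^ 2) := by
  have hn' : (0 : ℝ) < n := Nat.cast_pos.2 hn
  have hi : ∀ i : Fin n, MemLp (fun z : Fin n → Z => X (z i)) 2 (iidLaw P n) := fun i =>
    hLp.comp_measurePreserving (measurePreserving_eval (fun _ : Fin n => P) i)
  have hL : MemLp (∑ i, fun z : Fin n → Z => X (z i)) 2 (iidLaw P n) :=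
    memLp_finsetSum' _ fun i _ => hi i
  have h := meas_ge_le_variance_div_sq hL (c := C * √n) (by positivity)
  have hvar : Var[∑ i, fun z : Fin n → Z => X (z i); iidLaw P n] = n * Var[X; P] := by
    have := variance_sum_pi (μ := fun _ : Fin n => P) (X := fun _ => X) fun _ => hLp
    rw [iidLaw, this]
    simp
  have hmean : ∫ z, (∑ i, fun z : Fin n → Z => X (z i)) z ∂iidLaw P n = n * ∫ x, X x ∂P := by
    simp_rw [Finset.sum_apply]
    rw [integral_finsetSum _ fun i _ => (hi i).integrable (by norm_num)]
    have : ∀ i : Fin n, ∫ z, X (z i) ∂iidLaw P n = ∫ x, X x ∂P := fun i =>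
      integral_comp_eval (μ := fun _ : Fin n => P) (i := i) hX.aestronglyMeasurable
    simp [this]
  rw [hvar, hmean] at h
  simp only [Finset.sum_apply] at h
  refine h.trans (ENNReal.ofReal_le_ofReal ?_)
  rw [mul_pow, Real.sq_sqrt hn'.le, div_le_div_iff₀ (by positivity) (by positivity)]
  nlinarith [mul_le_mul_of_nonneg_right hV (by positivity : 0 ≤ (n : ℝ) * C ^ 2)]

/-- Fubini: for every `z` the means `μ` with `|T(z) - nμ| < w` form an interval of length
`2w/n`. -/
lemma lintegral_measure_abs_sub_lt {Ω : Type*} [MeasurableSpace Ω] (Q : Measure Ω)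
    [IsProbabilityMeasure Q] {T : Ω → ℝ} (hT : Measurable T) {n w : ℝ} (hn : 0 < n) :
    ∫⁻ μ : ℝ, Q {z | |T z - n * μ| < w} = ENNReal.ofReal (2 * w / n) := by
  have hms : MeasurableSet {p : ℝ × Ω | |T p.2 - n * p.1| < w} :=
    measurableSet_lt (by fun_prop) measurable_const
  have h1 := Measure.prod_apply (μ := (volume : Measure ℝ)) (ν := Q) hms
  have h2 := Measure.prod_apply_symm (μ := (volume : Measure ℝ)) (ν := Q) hms
  have h3 : ∀ z, (fun μ : ℝ => (μ, z)) ⁻¹' {p : ℝ × Ω | |T p.2 - n * p.1| < w} =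
      Metric.ball (T z / n) (w / n) := by
    intro z
    ext μ
    have h4 : T z - n * μ = n * (T z / n - μ) := by field_simp
    simp only [Set.mem_preimage, Set.mem_ofPred_eq, Metric.mem_ball, Real.dist_eq]
    rw [h4, abs_mul, abs_of_pos hn, abs_sub_comm, lt_div_iff₀ hn, mul_comm]
  calc ∫⁻ μ : ℝ, Q {z | |T z - n * μ| < w}
      = ∫⁻ z, volume ((fun μ : ℝ => (μ, z)) ⁻¹' {p : ℝ × Ω | |T p.2 - n * p.1| < w}) ∂Q :=
        h1.symm.trans h2
    _ = ENNReal.ofReal (2 * w / n) := by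
        simp_rw [h3, Real.volume_ball]
        rw [lintegral_const, measure_univ, mul_one]
        congr 1
        ring

variable {ν : Measure Z} {X : Z → ℝ}

/-- The cumulative expected divergence `∑_{i<n} E[D(P_μ ‖ P_{eᵢ(Z₁,…,Zᵢ)})]` of a sequence of
estimates from the true mean `μ`. -/
def cumulativeRisk (P : ExpFamily ν X) (e : (i : ℕ) → (Fin i → Z) → ℝ) (n : ℕ) (μ : ℝ) : ℝ≥0∞ :=
  ∑ i ∈ Finset.range n, ∫⁻ z, ENNReal.ofReal (P.klDivergence μ (e i z)) ∂iidLaw (P.dist μ) i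

lemma cumulativeRisk_mono (P : ExpFamily ν X) (e : (i : ℕ) → (Fin i → Z) → ℝ) (μ : ℝ) :
    Monotone fun n => cumulativeRisk P e n μ := fun _ _ h =>
  Finset.sum_le_sum_of_subset (Finset.range_mono h)

/-- If the forecast distribution `e^{-S}Pⁿ` has small divergence from `Pⁿ`, then it gives mass at
least of the order `e^{-t}` to every event that has large `Pⁿ`-probability: `S` has expectation
at most `ρ`, and `E[S⁻] ≤ 1`, so that Markov's inequality bounds the probability of `S ≥ t`. -/
lemma le_lintegral_exp_neg_scoreSum {P : Measure Z} [IsProbabilityMeasure P]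
    {y : (i : ℕ) → (Fin i → Z) → Z → ℝ} {D : (i : ℕ) → (Fin i → Z) → ℝ}
    (hy : ∀ i, Measurable fun p : (Fin i → Z) × Z => y i p.1 p.2)
    (hD : ∀ i, Measurable (D i)) (hint : ∀ i a, Integrable (y i a) P)
    (hyD : ∀ i a, ∫ b, y i a b ∂P = D i a) (hD0 : ∀ i a, 0 ≤ D i a)
    (hexp : ∀ i a, ∫⁻ b, ENNReal.ofReal (Real.exp (-y i a b)) ∂P = 1) {n : ℕ} {ρ t q : ℝ}
    (hρ : 0 ≤ ρ) (ht : 0 < t) (hq : 0 ≤ q)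
    (hsum : ∑ i ∈ Finset.range n, ∫⁻ z, ENNReal.ofReal (D i z) ∂iidLaw P i ≤ ENNReal.ofReal ρ)
    {E : Set (Fin n → Z)} (hE : MeasurableSet E) (hEq : iidLaw P n Eᶜ ≤ ENNReal.ofReal q) :
    ENNReal.ofReal (Real.exp (-t) * (1 - q - (1 + ρ) / t)) ≤
      ∫⁻ z in E, ENNReal.ofReal (Real.exp (-scoreSum y n z)) ∂iidLaw P n := by
  have hneg : ∀ n, ∫⁻ z, ENNReal.ofReal (-scoreSum y n z) ∂iidLaw P n ≤ 1 := by
    intro n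
    rw [← lintegral_exp_neg_scoreSum hy hexp n]
    refine lintegral_mono fun z => ENNReal.ofReal_le_ofReal ?_
    linarith [Real.add_one_le_exp (-scoreSum y n z)]
  have hS := measurable_scoreSum hy n
  have hpos : ∫⁻ z, ENNReal.ofReal (scoreSum y n z) ∂iidLaw P n ≤ ENNReal.ofReal (1 + ρ) := by
    rw [lintegral_scoreSum_of_neg_ne_top hy hD hint hyD hD0
      (fun m => ne_top_of_le_ne_top (by finiteness) (hneg m)) n
      (ne_top_of_le_ne_top (by finiteness) hsum), ENNReal.ofReal_add zero_le_one hρ,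
      ENNReal.ofReal_one]
    exact add_le_add (hneg n) hsum
  have hmarkov : iidLaw P n {z | t ≤ scoreSum y n z} ≤ ENNReal.ofReal ((1 + ρ) / t) := by
    have h1 := meas_ge_le_lintegral_div (μ := iidLaw P n)
      (f := fun z => ENNReal.ofReal (scoreSum y n z))
      hS.ennreal_ofReal.aemeasurable (ε := ENNReal.ofReal t) (by simpa using ht) (by finiteness)
    rw [ENNReal.ofReal_div_of_pos ht]
    refine le_trans (measure_mono fun z hz => ?_) (h1.trans (ENNReal.div_le_div_right hpos _))
    exact ENNReal.ofReal_le_ofReal hz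
  set G : Set (Fin n → Z) := E ∩ {z | scoreSum y n z < t} with hG
  have hGm : MeasurableSet G := hE.inter (measurableSet_lt hS measurable_const)
  have hGc : iidLaw P n Gᶜ ≤ ENNReal.ofReal (q + (1 + ρ) / t) := by
    rw [hG, Set.compl_inter, ENNReal.ofReal_add hq (by positivity)]
    refine (measure_union_le _ _).trans (add_le_add hEq ?_)
    have hc : {z | scoreSum y n z < t}ᶜ = {z | t ≤ scoreSum y n z} := by ext; simp
    rw [hc]
    exact hmarkov
  have hGp : ENNReal.ofReal (1 - q - (1 + ρ) / t) ≤ iidLaw P n G := by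
    have h1 : (1 : ℝ≥0∞) ≤ iidLaw P n G + ENNReal.ofReal (q + (1 + ρ) / t) := by
      rw [← prob_add_prob_compl (μ := iidLaw P n) hGm]
      gcongr
    rw [sub_sub, ENNReal.ofReal_sub _ (by positivity), ENNReal.ofReal_one]
    exact tsub_le_iff_right.2 h1
  calc ENNReal.ofReal (Real.exp (-t) * (1 - q - (1 + ρ) / t))
      = ENNReal.ofReal (Real.exp (-t)) * ENNReal.ofReal (1 - q - (1 + ρ) / t) :=
        ENNReal.ofReal_mul (Real.exp_nonneg _)
    _ ≤ ENNReal.ofReal (Real.exp (-t)) * iidLaw P n G := by gcongr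
    _ = ∫⁻ _ in G, ENNReal.ofReal (Real.exp (-t)) ∂iidLaw P n := by rw [setLIntegral_const]
    _ ≤ ∫⁻ z in G, ENNReal.ofReal (Real.exp (-scoreSum y n z)) ∂iidLaw P n := by
        refine setLIntegral_mono' hGm fun z hz => ENNReal.ofReal_le_ofReal ?_
        exact Real.exp_le_exp.2 (neg_le_neg (le_of_lt hz.2))
    _ ≤ _ := lintegral_mono_set Set.inter_subset_left

section Rissanen

variable (P : ExpFamily ν X) (hX : Measurable X)
  (hvar : ∀ η ∈ P.natSpace, 0 < Var[X; P.natDist η]) {a b : ℝ} (hab : Set.Icc a b ⊆ P.meanSpace)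
  {e : (i : ℕ) → (Fin i → Z) → ℝ} (he : ∀ i, Measurable (e i)) (hmem : ∀ i z, e i z ∈ Set.Icc a b)

include hX hvar hab he hmem

/-- The set of means for which the estimates do better than `(1-ε)/2 · ln n` has small volume. For
such a mean `μ` the distribution of the sequential forecasts gives mass of order at least
`n^{-(1-ε²)/2}` to the data sets whose empirical mean is within `O(n^{-1/2})` of `μ`; since it is a
single probability measure, Fubini's theorem shows that few `μ` qualify. -/
lemma exists_volume_cumulativeRisk_lt_le {ε : ℝ} (hε : 0 < ε) (hε1 : ε < 1) :
    ∃ K : ℝ, 0 ≤ K ∧ ∀ n : ℕ, 0 < n →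
      volume {μ | μ ∈ Set.Icc a b ∧
          cumulativeRisk P e n μ < ENNReal.ofReal ((1 - ε) / 2 * Real.log n)} ≤
        ENNReal.ofReal (K * (n : ℝ) ^ (-(ε ^ 2 / 2))) := by
  obtain ⟨V, hV0, hV⟩ := P.exists_variance_le hX hvar hab
  -- `C` makes Chebyshev's bound `V / C²` equal to `δ`, and `t` below makes Markov's bound
  -- `(1 + ρ) / t` equal to `1 / (1 + ε) = 1 - 2δ`, so that probability `δ` remains.
  set δ : ℝ := ε / (2 * (1 + ε)) with hδ
  have hδ0 : 0 < δ := by positivity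
  set C : ℝ := √(V / δ) with hC
  have hC0 : 0 < C := Real.sqrt_pos.2 (by positivity)
  have hVC : V / C ^ 2 = δ := by
    rw [hC, Real.sq_sqrt (by positivity)]
    field_simp
  refine ⟨2 * C * Real.exp (1 + ε) / δ, by positivity, fun n hn => ?_⟩
  have hn' : (0 : ℝ) < n := Nat.cast_pos.2 hn
  -- all forecasts lie in the interval, hence it is nonempty
  obtain ⟨z₀⟩ : Nonempty (Fin 0 → Z) := ⟨fun i => i.elim0⟩
  have hμ₀ := hmem 0 z₀
  set μ₀ := e 0 z₀
  let y : ℝ → (i : ℕ) → (Fin i → Z) → Z → ℝ := fun μ i a z => P.logRatio μ (e i a) z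
  have hy : ∀ μ i, Measurable fun p : (Fin i → Z) × Z => y μ i p.1 p.2 := fun μ i =>
    P.measurable_logRatio hX hvar μ (he i) fun z => hab (hmem i z)
  have hyd : ∀ μ ∈ Set.Icc a b, ∀ i a, (P.dist μ).withDensity
      (fun z => ENNReal.ofReal (Real.exp (-y μ i a z))) = P.dist (e i a) := fun μ hμ i a =>
    P.withDensity_exp_neg_logRatio hX (hab hμ) (hab (hmem i a))
  have hexp : ∀ μ ∈ Set.Icc a b, ∀ i a,
      ∫⁻ z, ENNReal.ofReal (Real.exp (-y μ i a z)) ∂P.dist μ = 1 := by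
    intro μ hμ i a
    have := P.isProbabilityMeasure_dist hX (hab (hmem i a))
    rw [← setLIntegral_univ, ← withDensity_apply _ MeasurableSet.univ, hyd μ hμ i a, measure_univ]
  have := P.isProbabilityMeasure_dist hX (hab hμ₀)
  set Q := (iidLaw (P.dist μ₀) n).withDensity
    (fun z => ENNReal.ofReal (Real.exp (-scoreSum (y μ₀) n z))) with hQ
  have hQprob : IsProbabilityMeasure Q := by
    refine ⟨?_⟩
    rw [hQ, withDensity_apply _ MeasurableSet.univ, setLIntegral_univ]
    exact lintegral_exp_neg_scoreSum (hy μ₀) (hexp μ₀ hμ₀) n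
  have hQE : ∀ μ ∈ Set.Icc a b, ∀ E : Set (Fin n → Z), MeasurableSet E →
      ∫⁻ z in E, ENNReal.ofReal (Real.exp (-scoreSum (y μ) n z)) ∂iidLaw (P.dist μ) n = Q E := by
    intro μ hμ E hE
    have := P.isProbabilityMeasure_dist hX (hab hμ)
    have h := lintegral_mul_exp_neg_scoreSum_congr (hy μ) (hy μ₀)
      (fun i a => (hyd μ hμ i a).trans (hyd μ₀ hμ₀ i a).symm) n
      (measurable_one.indicator hE : Measurable (E.indicator (1 : (Fin n → Z) → ℝ≥0∞)))
    have h1 : ∀ μ, ∫⁻ z, ENNReal.ofReal (Real.exp (-scoreSum (y μ) n z)) *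
        E.indicator (1 : (Fin n → Z) → ℝ≥0∞) z ∂iidLaw (P.dist μ) n =
        ∫⁻ z in E, ENNReal.ofReal (Real.exp (-scoreSum (y μ) n z)) ∂iidLaw (P.dist μ) n := by
      intro μ
      rw [← lintegral_indicator hE]
      refine lintegral_congr fun z => ?_
      by_cases hz : z ∈ E <;> simp [hz]
    rw [h1, h1] at h
    rw [h, hQ, withDensity_apply _ hE]
  let T : (Fin n → Z) → ℝ := fun z => ∑ i, X (z i)
  have hT : Measurable T := by fun_prop
  set ρ : ℝ := (1 - ε) / 2 * Real.log n with hρ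
  have hρ0 : 0 ≤ ρ := mul_nonneg (by linarith) (Real.log_natCast_nonneg n)
  set t : ℝ := (1 + ε) * (1 + ρ) with ht
  have ht0 : 0 < t := by positivity
  have hsub : {μ | μ ∈ Set.Icc a b ∧ cumulativeRisk P e n μ < ENNReal.ofReal ρ} ⊆
      {μ | ENNReal.ofReal (Real.exp (-t) * δ) ≤ Q {z | |T z - n * μ| < C * √n}} := by
    rintro μ ⟨hμ, hr⟩
    have := P.isProbabilityMeasure_dist hX (hab hμ)
    have hEm : MeasurableSet {z | |T z - n * μ| < C * √n} :=
      measurableSet_lt (by fun_prop) measurable_const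
    have hch := iidLaw_abs_sum_sub_ge_le (P := P.dist μ) hX
      (P.memLp_natDist hX (P.natOf_mem (hab hμ))) (hV μ hμ) hn hC0
    change iidLaw (P.dist μ) n {z | C * √n ≤ |∑ i, X (z i) - n * ∫ x, X x ∂P.dist μ|} ≤ _ at hch
    rw [P.integral_dist (hab hμ), hVC] at hch
    have hlow := le_lintegral_exp_neg_scoreSum (P := P.dist μ) (y := y μ)
      (D := fun i z => P.klDivergence μ (e i z)) (hy μ)
      (fun i => P.measurable_klDivergence hX hvar μ (he i) fun z => hab (hmem i z))
      (fun i z => P.integrable_logRatio (P.integrable_dist hX (hab hμ)) _ _)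
      (fun i z => P.integral_logRatio (P.integrable_dist hX (hab hμ)) (P.integral_dist (hab hμ)) _)
      (fun i z => P.klDivergence_nonneg hX hvar (hab hμ) (hab (hmem i z))) (hexp μ hμ) hρ0 ht0
      hδ0.le hr.le hEm (by
        refine le_trans (measure_mono fun z hz => ?_) hch
        simpa [T] using hz)
    rw [hQE μ hμ _ hEm] at hlow
    have hδ' : 1 - δ - (1 + ρ) / t = δ := by
      rw [ht, hδ]
      have : 1 + ρ ≠ 0 := by positivity
      field_simp
      ring
    rwa [hδ'] at hlow
  have hpos : 0 < Real.exp (-t) * δ := by positivity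
  have hmeas : AEMeasurable (fun μ : ℝ => Q {z | |T z - n * μ| < C * √n}) volume := by
    have hms : MeasurableSet {p : ℝ × (Fin n → Z) | |T p.2 - n * p.1| < C * √n} :=
      measurableSet_lt (by fun_prop) measurable_const
    exact (measurable_measure_prodMk_left (ν := Q) hms).aemeasurable
  refine (measure_mono hsub).trans ((meas_ge_le_lintegral_div hmeas
    (by simpa using hpos) (by finiteness)).trans_eq ?_)
  rw [lintegral_measure_abs_sub_lt Q hT hn', ← ENNReal.ofReal_div_of_pos hpos]
  congr 1
  have hexp_t : Real.exp t = Real.exp (1 + ε) * (n : ℝ) ^ ((1 - ε ^ 2) / 2) := by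
    rw [Real.rpow_def_of_pos hn', ← Real.exp_add, ht, hρ]
    congr 1
    ring
  have hsq : √(n : ℝ) / n = (n : ℝ) ^ (-(1 / 2) : ℝ) := by
    rw [Real.sqrt_eq_rpow, ← Real.rpow_sub_one hn'.ne']
    norm_num
  calc 2 * (C * √n) / n / (Real.exp (-t) * δ) = 2 * C / δ * (√n / n) * Real.exp t := by
        rw [Real.exp_neg]
        field_simp
    _ = 2 * C * Real.exp (1 + ε) / δ *
          ((n : ℝ) ^ (-(1 / 2) : ℝ) * (n : ℝ) ^ ((1 - ε ^ 2) / 2)) := by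
        rw [hsq, hexp_t]
        ring
    _ = 2 * C * Real.exp (1 + ε) / δ * (n : ℝ) ^ (-(ε ^ 2 / 2)) := by
        rw [← Real.rpow_add hn']
        congr 2
        ring

/-- For almost every mean the cumulative divergence of sequential estimates is at least
`½ ln n`, to first order. By Borel–Cantelli the bound holds along `n = 2ᵏ`, and the cumulative
divergence is monotone in `n`. -/
lemma ae_eventually_le_cumulativeRisk {c : ℝ} (hc0 : 0 < c) (hc1 : c < 1) :
    ∀ᵐ μ : ℝ, μ ∈ Set.Icc a b →
      ∀ᶠ n : ℕ in atTop, ENNReal.ofReal (c / 2 * Real.log n) ≤ cumulativeRisk P e n μ := by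
  -- with this `ε`, `c ≤ (1 - ε)²`: one factor for the bound along `2ᵏ`, one for the gaps
  set ε : ℝ := (1 - c) / 2 with hε
  have hε0 : 0 < ε := by linarith
  have hε1 : ε < 1 := by linarith
  obtain ⟨K, hK, hvol⟩ := exists_volume_cumulativeRisk_lt_le P hX hvar hab he hmem hε0 hε1
  have hsum : ∑' k : ℕ, volume {μ | μ ∈ Set.Icc a b ∧
      cumulativeRisk P e (2 ^ k) μ < ENNReal.ofReal ((1 - ε) / 2 * Real.log (2 ^ k : ℕ))} ≠ ∞ := by
    set r : ℝ := (2 : ℝ) ^ (-(ε ^ 2 / 2)) with hr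
    have hr1 : r < 1 := Real.rpow_lt_one_of_one_lt_of_neg (by norm_num) (by
      have : 0 < ε ^ 2 := by positivity
      linarith)
    have hs : Summable fun k : ℕ => K * r ^ k :=
      (summable_geometric_of_lt_one (by positivity) hr1).mul_left K
    refine ne_top_of_le_ne_top hs.tsum_ofReal_ne_top (ENNReal.tsum_le_tsum fun k => ?_)
    refine (hvol (2 ^ k) (by positivity)).trans_eq ?_
    congr 2
    rw [hr, Real.rpow_pow_comm (by norm_num), Nat.cast_pow, Nat.cast_ofNat]
  filter_upwards [ae_eventually_notMem hsum] with μ hμ hμab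
  have hlog : Tendsto (fun n : ℕ => Nat.log 2 n) atTop atTop := by
    refine tendsto_atTop.2 fun m => ?_
    filter_upwards [eventually_ge_atTop (2 ^ m)] with n hn
    exact (Nat.le_log_iff_pow_le (by norm_num) (by
      have : 0 < 2 ^ m := by positivity
      omega)).2 hn
  have hk : ∀ᶠ k : ℕ in atTop, (1 - ε) * (k + 1) ≤ (k : ℝ) := by
    filter_upwards [eventually_ge_atTop ⌈1 / ε⌉₊] with k hk
    have h1 : 1 / ε ≤ k := (Nat.le_ceil _).trans (Nat.cast_le.2 hk)
    rw [div_le_iff₀ hε0] at h1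
    nlinarith
  filter_upwards [hlog.eventually hμ, hlog.eventually hk, eventually_ge_atTop 1] with n hn1 hn2 hn3
  set k := Nat.log 2 n
  have hn0 : n ≠ 0 := by omega
  have hlow : ENNReal.ofReal ((1 - ε) / 2 * Real.log (2 ^ k : ℕ)) ≤
      cumulativeRisk P e (2 ^ k) μ := by
    by_contra h
    exact hn1 ⟨hμab, not_le.1 h⟩
  refine le_trans (ENNReal.ofReal_le_ofReal ?_)
    (hlow.trans (cumulativeRisk_mono P e μ (Nat.pow_log_le_self 2 hn0)))
  have hlogn : Real.log n ≤ (k + 1) * Real.log 2 := by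
    have h1 : (n : ℝ) ≤ 2 ^ (k + 1) := by
      exact_mod_cast (Nat.lt_pow_succ_log_self (by norm_num) n).le
    have h2 := Real.log_le_log (by positivity) h1
    rw [Real.log_pow] at h2
    exact_mod_cast h2
  have hl2 : 0 < Real.log 2 := Real.log_pos (by norm_num)
  rw [Nat.cast_pow, Nat.cast_ofNat, Real.log_pow]
  calc c / 2 * Real.log n ≤ c / 2 * ((k + 1) * Real.log 2) := by gcongr
    _ ≤ (1 - ε) * (1 - ε) / 2 * ((k + 1) * Real.log 2) := by
        gcongr
        nlinarith
    _ = (1 - ε) / 2 * Real.log 2 * ((1 - ε) * (k + 1)) := by ring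
    _ ≤ (1 - ε) / 2 * Real.log 2 * k := by
        gcongr
    _ = (1 - ε) / 2 * (k * Real.log 2) := by ring

end Rissanen

end PlugInCodes

/-! ### Extended expectations of code lengths -/

namespace PlugInCodes

lemma coe_sum_ereal {ι : Type*} (s : Finset ι) (f : ι → ℝ) :
    ((∑ i ∈ s, f i : ℝ) : EReal) = ∑ i ∈ s, (f i : EReal) :=
  map_sum (⟨⟨Real.toEReal, EReal.coe_zero⟩, EReal.coe_add⟩ : ℝ →+ EReal) f s

section Expect

variable {Ω : Type*} [MeasurableSpace Ω] {P : Measure Ω} {f : Ω → EReal} {g : Ω → ℝ}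

lemma lintegral_toENNReal_congr (h : ∀ᵐ x ∂P, f x = g x) :
    ∫⁻ x, (f x).toENNReal ∂P = ∫⁻ x, ENNReal.ofReal (g x) ∂P :=
  lintegral_congr_ae (h.mono fun x hx => by simp [hx])

lemma lintegral_neg_toENNReal_congr (h : ∀ᵐ x ∂P, f x = g x) :
    ∫⁻ x, (-f x).toENNReal ∂P = ∫⁻ x, ENNReal.ofReal (-g x) ∂P :=
  lintegral_congr_ae (h.mono fun x hx => by
    simp only [hx, ← EReal.coe_neg, EReal.real_coe_toENNReal])

lemma expect_eq_integral (h : ∀ᵐ x ∂P, f x = g x) (hg : Integrable g P) :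
    expect P f = ((∫ x, g x ∂P : ℝ) : EReal) := by
  have hp : ∫⁻ x, ENNReal.ofReal (g x) ∂P ≠ ∞ := hg.lintegral_lt_top.ne
  have hn : ∫⁻ x, ENNReal.ofReal (-g x) ∂P ≠ ∞ := hg.neg.lintegral_lt_top.ne
  rw [expect, lintegral_toENNReal_congr h, lintegral_neg_toENNReal_congr h, if_neg hp,
    integral_eq_lintegral_pos_part_sub_lintegral_neg_part hg, EReal.coe_sub,
    EReal.coe_ennreal_toReal hp, EReal.coe_ennreal_toReal hn]

lemma integrable_of_lintegral_ofReal_ne_top (hg : AEStronglyMeasurable g P)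
    (hp : ∫⁻ x, ENNReal.ofReal (g x) ∂P ≠ ∞) (hn : ∫⁻ x, ENNReal.ofReal (-g x) ∂P ≠ ∞) :
    Integrable g P := by
  refine ⟨hg, ?_⟩
  rw [hasFiniteIntegral_iff_norm]
  have h : ∀ x, ENNReal.ofReal ‖g x‖ ≤ ENNReal.ofReal (g x) + ENNReal.ofReal (-g x) := by
    intro x
    rw [Real.norm_eq_abs]
    rcases abs_cases (g x) with h | h <;> rw [h.1]
    · exact le_self_add
    · exact le_add_self
  refine (lintegral_mono h).trans_lt ?_
  rw [lintegral_add_left' hg.aemeasurable.ennreal_ofReal]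
  exact ENNReal.add_lt_top.2 ⟨hp.lt_top, hn.lt_top⟩

lemma integrable_of_expect_ne (h : ∀ᵐ x ∂P, f x = g x) (hg : AEStronglyMeasurable g P)
    (h_top : expect P f ≠ ⊤) (h_bot : expect P f ≠ ⊥) : Integrable g P := by
  rw [expect, lintegral_toENNReal_congr h, lintegral_neg_toENNReal_congr h] at h_top h_bot
  have hp : ∫⁻ x, ENNReal.ofReal (g x) ∂P ≠ ∞ := fun hp => h_top (if_pos hp)
  rw [if_neg hp] at h_bot
  refine integrable_of_lintegral_ofReal_ne_top hg hp fun hn => h_bot ?_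
  rw [hn, EReal.coe_ennreal_top, EReal.sub_top]

end Expect

namespace ExpFamily

variable {Z : Type*} [MeasurableSpace Z] {ν : Measure Z} {X : Z → ℝ} (M : ExpFamily ν X)

/-- The log loss as a real number; it is `M.logLoss` where the carrier does not vanish. -/
def realLogLoss (μ : ℝ) (z : Z) : ℝ :=
  M.natOf μ * X z + M.logPart (M.natOf μ) - Real.log (M.carrier z)

variable {M} (hX : Measurable X)

include hX

lemma measurable_realLogLoss (μ : ℝ) : Measurable (M.realLogLoss μ) := by
  have := M.measurable_carrier
  unfold realLogLoss
  fun_prop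

lemma logLoss_eq_coe {μ : ℝ} (hμ : μ ∈ M.meanSpace) {z : Z} (hz : M.carrier z ≠ 0) :
    M.logLoss μ z = (M.realLogLoss μ z : EReal) := by
  have hz' : (0 : ℝ) < M.carrier z := NNReal.coe_pos.2 (pos_iff_ne_zero.2 hz)
  rw [logLoss, density, M.natDensity_eq hX (M.natOf_mem hμ),
    ENNReal.log_ofReal_of_pos (by positivity), ← EReal.coe_neg,
    Real.log_mul (Real.exp_pos _).ne' hz'.ne', Real.log_exp, realLogLoss]
  congr 1
  ring

lemma ae_carrier_ne_zero {P : Measure Z} {μ : ℝ} (hμ : μ ∈ M.meanSpace)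
    (h : expect P (M.logLoss μ) ≠ ⊤) : ∀ᵐ z ∂P, M.carrier z ≠ 0 := by
  have hm : Measurable (M.logLoss μ) := by
    have hd : Measurable (M.density μ) := by
      have := M.measurable_carrier
      unfold density natDensity
      fun_prop
    exact (ENNReal.measurable_log.comp hd.ennreal_ofReal).neg
  have hne : ∫⁻ z, (M.logLoss μ z).toENNReal ∂P ≠ ∞ := fun h' => h (if_pos h')
  filter_upwards [ae_lt_top hm.ereal_toENNReal hne] with z hz h0
  have : M.logLoss μ z = ⊤ := by
    rw [logLoss, density, M.natDensity_eq hX (M.natOf_mem hμ), h0]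
    simp
  simp [this] at hz

omit hX in
lemma realLogLoss_eq_add_logRatio (μ μ' : ℝ) (z : Z) :
    M.realLogLoss μ' z = M.realLogLoss μ z + M.logRatio μ μ' z := by
  unfold realLogLoss logRatio
  ring

end ExpFamily

variable {Z : Type*} [MeasurableSpace Z] {ν : Measure Z} {X : Z → ℝ} {M : ExpFamily ν X}

lemma ae_iidLaw_forall {P : Measure Z} [IsProbabilityMeasure P] {p : Z → Prop}
    (h : ∀ᵐ z ∂P, p z) (n : ℕ) : ∀ᵐ z ∂iidLaw P n, ∀ i, p (z i) :=
  ae_all_iff.2 fun i =>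
    (measurePreserving_eval (fun _ : Fin n => P) i).quasiMeasurePreserving.ae h

/-- The redundancy is at least the cumulative expected divergence of the estimates. -/
lemma le_redundancy (hX : Measurable X) (hvar : ∀ η ∈ M.natSpace, 0 < Var[X; M.natDist η])
    (U : EstimatorSeq Z M.meanSpace) {P : Measure Z} [IsProbabilityMeasure P]
    (hXi : Integrable X P) {μ : ℝ} (hXμ : ∫ z, X z ∂P = μ) (hμ : μ ∈ M.meanSpace)
    (h_top : expect P (M.logLoss μ) ≠ ⊤) (h_bot : expect P (M.logLoss μ) ≠ ⊥) {n : ℕ} {r : ℝ}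
    (hr : ENNReal.ofReal r ≤ ∑ i ∈ Finset.range n,
      ∫⁻ z, ENNReal.ofReal (M.klDivergence μ (U.est i z)) ∂iidLaw P i) :
    (r : EReal) ≤ redundancy M U P n := by
  have hcar := M.ae_carrier_ne_zero hX hμ h_top
  have hloss : Integrable (M.realLogLoss μ) P :=
    integrable_of_expect_ne (hcar.mono fun z hz => M.logLoss_eq_coe hX hμ hz)
      (M.measurable_realLogLoss hX μ).aestronglyMeasurable h_top h_bot
  set H := ∫ z, M.realLogLoss μ z ∂P with hH
  have hbest : expect (iidLaw P n) (modelCodelength M μ n) = ((n * H : ℝ) : EReal) := by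
    have hi : ∀ i : Fin n, Integrable (fun z : Fin n → Z => M.realLogLoss μ (z i)) (iidLaw P n) :=
      fun i => integrable_comp_eval (μ := fun _ : Fin n => P) (i := i) hloss
    rw [expect_eq_integral (g := fun z => ∑ i, M.realLogLoss μ (z i)) ?_
      (integrable_finsetSum _ fun i _ => hi i), integral_finsetSum _ fun i _ => hi i]
    · have : ∀ i : Fin n, ∫ z, M.realLogLoss μ (z i) ∂iidLaw P n = H := fun i =>
        integral_comp_eval (μ := fun _ : Fin n => P) (i := i)
          (M.measurable_realLogLoss hX μ).aestronglyMeasurable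
      simp [this]
    · filter_upwards [ae_iidLaw_forall hcar n] with z hz
      rw [modelCodelength, coe_sum_ereal]
      exact Finset.sum_congr rfl fun i _ => M.logLoss_eq_coe hX hμ (hz i)
  -- the centred loss of the `i`-th forecast, whose conditional mean is the divergence
  let y : (i : ℕ) → (Fin i → Z) → Z → ℝ := fun i a z => M.realLogLoss (U.est i a) z - H
  have hy_eq : ∀ i a z,
      y i a z = M.realLogLoss μ z + M.logRatio μ (U.est i a) z - H := fun i a z => by
    simp only [y]
    rw [M.realLogLoss_eq_add_logRatio μ (U.est i a) z]
  have hy : ∀ i, Measurable fun p : (Fin i → Z) × Z => y i p.1 p.2 := by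
    intro i
    have h1 := M.measurable_logRatio hX hvar μ (U.measurable_est i) (U.est_mem i)
    simp_rw [hy_eq]
    exact (((M.measurable_realLogLoss hX μ).comp measurable_snd).add h1).sub_const H
  have hint : ∀ i a, Integrable (y i a) P := by
    intro i a
    simp_rw [funext (hy_eq i a)]
    exact (hloss.add (M.integrable_logRatio hXi μ _)).sub (integrable_const _)
  have hyD : ∀ i a, ∫ b, y i a b ∂P = M.klDivergence μ (U.est i a) := by
    intro i a
    simp_rw [hy_eq]
    have h1 : Integrable (fun z => M.realLogLoss μ z + M.logRatio μ (U.est i a) z) P :=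
      hloss.add (M.integrable_logRatio hXi μ _)
    rw [integral_sub h1 (integrable_const _), integral_add hloss (M.integrable_logRatio hXi μ _),
      M.integral_logRatio hXi hXμ]
    simp [hH]
  have hcode : ∀ᵐ z ∂iidLaw P n,
      plugInCodelength M U n z = ((scoreSum y n z + n * H : ℝ) : EReal) := by
    filter_upwards [ae_iidLaw_forall hcar n] with z hz
    have h1 : scoreSum y n z + n * H =
        ∑ i : Fin n, M.realLogLoss (U.est i (Fin.take i i.isLt.le z)) (z i) := by
      simp [scoreSum, y, Finset.sum_sub_distrib]
    rw [h1, plugInCodelength, coe_sum_ereal]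
    exact Finset.sum_congr rfl fun i _ => M.logLoss_eq_coe hX (U.est_mem _ _) (hz i)
  -- if the positive part is not integrable, the expectation is `⊤` by convention
  have hplug : ((n * H + r : ℝ) : EReal) ≤ expect (iidLaw P n) (plugInCodelength M U n) := by
    by_cases hfin : ∫⁻ z, ENNReal.ofReal (scoreSum y n z + n * H) ∂iidLaw P n = ∞
    · rw [expect, lintegral_toENNReal_congr hcode, if_pos hfin]
      exact le_top
    have hS := measurable_scoreSum hy n
    have hpos : ∫⁻ z, ENNReal.ofReal (scoreSum y n z) ∂iidLaw P n ≠ ∞ := by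
      have h1 : ∀ z, ENNReal.ofReal (scoreSum y n z) ≤
          ENNReal.ofReal (scoreSum y n z + n * H) + ENNReal.ofReal (-(n * H)) := by
        intro z
        refine le_trans (ENNReal.ofReal_le_ofReal ?_) ENNReal.ofReal_add_le
        linarith
      refine ne_top_of_le_ne_top ?_ (lintegral_mono h1)
      rw [lintegral_add_right _ measurable_const, lintegral_const, measure_univ, mul_one]
      exact ENNReal.add_ne_top.2 ⟨hfin, ENNReal.ofReal_ne_top⟩
    obtain ⟨hneg, heq⟩ := lintegral_scoreSum_of_pos_ne_top hy
      (fun i => M.measurable_klDivergence hX hvar μ (U.measurable_est i) (U.est_mem i)) hint hyD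
      (fun i a => M.klDivergence_nonneg hX hvar hμ (U.est_mem i a)) n hpos
    have hSi := integrable_of_lintegral_ofReal_ne_top hS.aestronglyMeasurable hpos hneg
    rw [expect_eq_integral hcode (hSi.add (integrable_const _)),
      integral_add hSi (integrable_const _), integral_const, probReal_univ, one_smul,
      integral_eq_lintegral_pos_part_sub_lintegral_neg_part hSi, EReal.coe_le_coe_iff]
    rw [heq] at hpos ⊢
    have hsum := (ENNReal.add_ne_top.1 hpos).2
    rw [ENNReal.toReal_add hneg hsum]
    linarith [(ENNReal.ofReal_le_iff_le_toReal hsum).1 hr]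
  calc (r : EReal) = ((n * H + r : ℝ) : EReal) - ((n * H : ℝ) : EReal) := by
        rw [← EReal.coe_sub]
        congr 1
        ring
    _ ≤ redundancy M U P n := EReal.sub_le_sub hplug (hbest ▸ iInf₂_le μ hμ)

end PlugInCodes

end

open PlugInCodes in
theorem theorem1 {Z : Type*} [MeasurableSpace Z]
    (νM νP : Measure Z) [SigmaFinite νM] [SigmaFinite νP]
    (X : Z → ℝ) (hX : Measurable X)
    (M : ExpFamily νM X) (P : ExpFamily νP X) (hΘ : M.meanSpace = P.meanSpace)
    (U : EstimatorSeq Z M.meanSpace) :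
    ∀ᵐ μs : ℝ ∂volume, μs ∈ M.meanSpace →
      -- the expected log loss of the best element of the model is finite
      expect (P.dist μs) (M.logLoss μs) ≠ ⊤ → expect (P.dist μs) (M.logLoss μs) ≠ ⊥ →
      ((Var[X; P.dist μs] / Var[X; M.dist μs] : ℝ) : EReal) ≤
        liminf (fun n : ℕ => redundancy M U (P.dist μs) n / ((1 / 2 * Real.log n : ℝ) : EReal))
          atTop := by
  rcases M.subsingleton_or_variance_pos hX with hM | hM
  · filter_upwards [measure_eq_zero_iff_ae_notMem.1 (hM.measure_zero volume)] with μ hμ h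
    exact absurd h hμ
  rcases P.subsingleton_or_variance_pos hX with hP | hP
  · rw [← hΘ] at hP
    filter_upwards [measure_eq_zero_iff_ae_notMem.1 (hP.measure_zero volume)] with μ hμ h
    exact absurd h hμ
  let e : ℚ → ℚ → (i : ℕ) → (Fin i → Z) → ℝ := fun a b i z => max a (min b (U.est i z))
  have hrisk : ∀ᵐ μ : ℝ, ∀ q : ℚ × ℚ × ℚ, Set.Icc (q.1 : ℝ) q.2.1 ⊆ P.meanSpace → 0 < q.2.2 →
      q.2.2 < 1 → μ ∈ Set.Icc (q.1 : ℝ) q.2.1 → ∀ᶠ n : ℕ in atTop,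
        ENNReal.ofReal (q.2.2 / 2 * Real.log n) ≤ cumulativeRisk P (e q.1 q.2.1) n μ := by
    refine ae_all_iff.2 fun q => ?_
    obtain ⟨a, b, c⟩ := q
    by_cases h : Set.Icc (a : ℝ) b ⊆ P.meanSpace ∧ 0 < c ∧ c < 1 ∧ (a : ℝ) ≤ b
    · obtain ⟨hab, hc0, hc1, hle⟩ := h
      have h1 := ae_eventually_le_cumulativeRisk P hX hP hab (e := e a b)
        (fun i => measurable_const.max (measurable_const.min (U.measurable_est i)))
        (fun i z => ⟨le_max_left _ _, max_le hle (min_le_left _ _)⟩)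
        (c := c) (by exact_mod_cast hc0) (by exact_mod_cast hc1)
      filter_upwards [h1] with μ hμ _ _ _ using hμ
    · exact ae_of_all _ fun μ hab hc0 hc1 hμ => absurd ⟨hab, hc0, hc1, hμ.1.trans hμ.2⟩ h
  filter_upwards [hrisk] with μ hμrisk hμ h_top h_bot
  have hμP : μ ∈ P.meanSpace := hΘ ▸ hμ
  have := P.isProbabilityMeasure_dist hX hμP
  have hvM : 0 < Var[X; M.dist μ] := hM _ (M.natOf_mem hμ)
  have hvP : 0 < Var[X; P.dist μ] := hP _ (P.natOf_mem hμP)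
  set ratio := Var[X; P.dist μ] / Var[X; M.dist μ] with hratio
  have hratio0 : 0 < ratio := div_pos hvP hvM
  by_contra hcon
  obtain ⟨x, hx1, hx2⟩ := EReal.lt_iff_exists_real_btwn.1 (not_le.1 hcon)
  rw [EReal.coe_lt_coe_iff] at hx2
  -- choose `k` and `c` with `x ≤ k c`, `k` below the ratio of the variances and `c < 1`
  obtain ⟨x', hx', hx'r⟩ := exists_between (max_lt hx2 hratio0)
  have hxx' : x < x' := (le_max_left _ _).trans_lt hx'
  have hx'0 : 0 < x' := (le_max_right _ _).trans_lt hx'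
  obtain ⟨k, hk, hkr⟩ := exists_between hx'r
  have hk0 : 0 < k := hx'0.trans hk
  obtain ⟨c, hc, hc1⟩ := exists_rat_btwn ((div_lt_one hk0).2 hk)
  have hc0 : (0 : ℝ) < c := (div_pos hx'0 hk0).trans hc
  rw [div_lt_iff₀ hk0] at hc
  -- an interval with rational endpoints around `μ` on which the variances have ratio above `k`
  have hnear : ∀ᶠ t in nhds μ, t ∈ M.meanSpace ∧ k * Var[X; M.dist t] ≤ Var[X; P.dist t] := by
    have hlt : k * Var[X; M.dist μ] < Var[X; P.dist μ] := (lt_div_iff₀ hvM).1 hkr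
    filter_upwards [(M.isOpen_meanSpace hX hM).mem_nhds hμ,
      ((M.continuousAt_variance_dist hX hM hμ).const_mul k).eventually_lt
        (P.continuousAt_variance_dist hX hP hμP) hlt] with t ht1 ht2 using ⟨ht1, ht2.le⟩
  obtain ⟨l, u, hlu, hsub⟩ := mem_nhds_iff_exists_Ioo_subset.1 hnear
  obtain ⟨a, ha1, ha2⟩ := exists_rat_btwn hlu.1
  obtain ⟨b, hb1, hb2⟩ := exists_rat_btwn hlu.2
  have hab : ∀ t ∈ Set.Icc (a : ℝ) b, t ∈ M.meanSpace ∧ k * Var[X; M.dist t] ≤ Var[X; P.dist t] :=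
    fun t ht => hsub ⟨ha1.trans_le ht.1, ht.2.trans_lt hb2⟩
  have hμab : μ ∈ Set.Icc (a : ℝ) b := ⟨ha2.le, hb1.le⟩
  have hev := hμrisk (a, b, c) (fun t ht => hΘ ▸ (hab t ht).1) (by exact_mod_cast hc0)
    (by exact_mod_cast hc1) hμab
  refine absurd (le_liminf_of_le (a := (x : EReal)) (by isBoundedDefault) ?_) (not_le.2 hx1)
  filter_upwards [hev, eventually_gt_atTop 1] with n hn hn1
  have hlog : 0 < Real.log n := Real.log_pos (by exact_mod_cast hn1)
  rw [EReal.le_div_iff_mul_le (by exact_mod_cast (by positivity : (0 : ℝ) < 1 / 2 * Real.log n))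
    (EReal.coe_ne_top _), ← EReal.coe_mul]
  refine le_redundancy hX hM U (P.integrable_dist hX hμP) (P.integral_dist hμP) hμ h_top h_bot ?_
  calc ENNReal.ofReal (x * (1 / 2 * Real.log n))
      ≤ ENNReal.ofReal (k * (c / 2 * Real.log n)) := by
        refine ENNReal.ofReal_le_ofReal ?_
        nlinarith
    _ = ENNReal.ofReal k * ENNReal.ofReal (c / 2 * Real.log n) := ENNReal.ofReal_mul hk0.le
    _ ≤ ENNReal.ofReal k * cumulativeRisk P (e a b) n μ := by gcongr
    _ = ∑ i ∈ Finset.range n, ENNReal.ofReal k *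
          ∫⁻ z, ENNReal.ofReal (P.klDivergence μ (e a b i z)) ∂iidLaw (P.dist μ) i :=
        Finset.mul_sum _ _ _
    _ ≤ _ := by
        refine Finset.sum_le_sum fun i _ => ?_
        rw [← lintegral_const_mul' _ _ ENNReal.ofReal_ne_top]
        refine lintegral_mono fun z => ?_
        rw [← ENNReal.ofReal_mul hk0.le]
        exact ENNReal.ofReal_le_ofReal (M.mul_klDivergence_clamp_le P hX hM hP hΘ
          (fun t ht => (hab t ht).1) (fun t ht => (hab t ht).2) hμab (U.est_mem i z))
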